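/- Let $n\ge 1$ and let $(M,\varphi,\xi,\eta,g)$ be a non-empty Riemannian $\Pi$-manifold of dimension $2n+1$: $M$ is a smooth manifold, $g$ a smooth Riemannian metric, $\varphi$ a smooth $(1,1)$-tensor field, $\xi$ a smooth vector field and $\eta$ a smooth $1$-form with $$\varphi\xi=0,\quad \varphi^2=I-\eta\otimes\xi,\quad \eta\circ\varphi=0,\quad \eta(\xi)=1,\quad \operatorname{tr}\varphi=0,\quad g(\varphi x,\varphi y)=g(x,y)-\eta(x)\eta(y).$$ Let $\nabla$ be the Levi-Civita connection of $g$, let $\rho(y,z)=\operatorname{tr}\bigl(x\mapsto R(x,y)z\bigr)$ be its Ricci tensor, where $R(x,y)z=\nabla_x\nabla_yz-\nabla_y\nabla_xz-\nabla_{[x,y]}z$, and let $\tilde g(x,y)=g(x,\varphi y)+\eta(x)\eta(y)$ be the associated metric. Assume that $M$ is para-Sasaki-like, that is, $$(\nabla_x\varphi)y=-g(x,y)\xi-\eta(y)x+2\eta(x)\eta(y)\xi,$$ and that it admits a para-Ricci-like soliton with an arbitrary smooth potential vector field $v$ and real constants $(\lambda,\mu,\nu)$, that is, $$\rho=-\tfrac12\mathcal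 L_v g-\lambda\, g-\mu\,\tilde g-\nu\,\eta\otimes\eta .$$ Then $\lambda+\mu+\nu=2n$ and $\nabla_\xi v=\varphi v$. Moreover, $\mathcal L_v\xi=0$. -/

import Mathlib

open Bundle Manifold VectorField FiberBundle
open scoped ContDiff

set_option linter.unusedSectionVars false

noncomputable section

section LeviCivita

variable {E : Type*} [NormedAddCommGroup E] [NormedSpace ℝ E] [FiniteDimensional ℝ E]
  {H : Type*} [TopologicalSpace H] (I : ModelWithCorners ℝ E H)
  {M : Type*} [TopologicalSpace M] [ChartedSpace H M] [IsManifold I 2 M]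
  [RiemannianBundle (fun x : M ↦ TangentSpace I x)]
  [IsContMDiffRiemannianBundle I 1 E (fun x : M ↦ TangentSpace I x)]

/-- The right-hand side of Koszul's formula for `g(∇_X Y, Z)` at the point `x`. -/
def koszul (Y X Z : Π x : M, TangentSpace I x) (x : M) : ℝ :=
  (1 / 2 : ℝ) *
    (d% (fun p ↦ inner ℝ (Y p) (Z p)) x (X x)
      + d% (fun p ↦ inner ℝ (Z p) (X p)) x (Y x)
      - d% (fun p ↦ inner ℝ (X p) (Y p)) x (Z x)
      + inner ℝ (mlieBracket I X Y x) (Z x)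
      - inner ℝ (mlieBracket I Y Z x) (X x)
      + inner ℝ (mlieBracket I Z X x) (Y x))

variable {I} {x : M}

theorem mdifferentiableAt_metric {X Y : Π x : M, TangentSpace I x}
    (hX : MDiffAt (T% X) x) (hY : MDiffAt (T% Y) x) :
    MDiffAt (fun p ↦ (inner ℝ (X p) (Y p) : ℝ)) x :=
  MDifferentiableAt.inner_bundle (E := fun x : M ↦ TangentSpace I x) hX hY

theorem koszul_tensorial_left {Y Z : Π x : M, TangentSpace I x}
    (hY : MDiffAt (T% Y) x) (hZ : MDiffAt (T% Z) x) :
    TensorialAt I E (fun X ↦ koszul I Y X Z x) x where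
  smul {f X} hf hX := by
    have h1 := mdifferentiableAt_metric hZ hX
    have h2 := mdifferentiableAt_metric hX hY
    simp [koszul, mlieBracket_smul_left hf hX, mlieBracket_smul_right hf hX,
      inner_add_left, inner_smul_left, inner_smul_right, mvfderiv_fun_mul hf h1,
      mvfderiv_fun_mul hf h2]
    rw [real_inner_comm (Y x) (X x), real_inner_comm (Z x) (X x)]
    ring
  add {X X'} hX hX' := by
    simp [koszul, mlieBracket_add_left hX hX', mlieBracket_add_right hX hX',
      inner_add_left, inner_add_right,
      mvfderiv_fun_add (mdifferentiableAt_metric hZ hX) (mdifferentiableAt_metric hZ hX'),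
      mvfderiv_fun_add (mdifferentiableAt_metric hX hY) (mdifferentiableAt_metric hX' hY)]
    ring

theorem koszul_tensorial_right {Y X : Π x : M, TangentSpace I x}
    (hY : MDiffAt (T% Y) x) (hX : MDiffAt (T% X) x) :
    TensorialAt I E (fun Z ↦ koszul I Y X Z x) x where
  smul {f Z} hf hZ := by
    have h1 := mdifferentiableAt_metric hY hZ
    have h2 := mdifferentiableAt_metric hZ hX
    simp [koszul, mlieBracket_smul_left hf hZ, mlieBracket_smul_right hf hZ,
      inner_add_left, inner_smul_left, inner_smul_right, mvfderiv_fun_mul hf h1,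
      mvfderiv_fun_mul hf h2]
    rw [real_inner_comm (Y x) (Z x), real_inner_comm (X x) (Z x)]
    ring
  add {Z Z'} hZ hZ' := by
    simp [koszul, mlieBracket_add_left hZ hZ', mlieBracket_add_right hZ hZ',
      inner_add_left, inner_add_right,
      mvfderiv_fun_add (mdifferentiableAt_metric hY hZ) (mdifferentiableAt_metric hY hZ'),
      mvfderiv_fun_add (mdifferentiableAt_metric hZ hX) (mdifferentiableAt_metric hZ' hX)]
    ring

instance (x : M) : FiniteDimensional ℝ (TangentSpace I x) :=
  inferInstanceAs (FiniteDimensional ℝ E)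

/-- Koszul's formula, for a fixed vector field `Y` differentiable at `x`, as a bilinear form
`(X, Z) ↦ g(∇_X Y, Z)` on the tangent space at `x`. -/
def koszulForm {Y : Π x : M, TangentSpace I x} (hY : MDiffAt (T% Y) x) :
    TangentSpace I x →L[ℝ] TangentSpace I x →L[ℝ] ℝ :=
  TensorialAt.mkHom₂ (fun X Z ↦ koszul I Y X Z x) x
    (fun _ hZ ↦ koszul_tensorial_left hY hZ) (fun _ hX ↦ koszul_tensorial_right hY hX)

open Classical in
/-- `∇Y` at the point `x`, as the linear map `X ↦ ∇_X Y` whose scalar products with tangent vectors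
are given by Koszul's formula. The value is `0` if `Y` is not differentiable at `x`. -/
def leviCivitaFun (Y : Π x : M, TangentSpace I x) (x : M) :
    TangentSpace I x →L[ℝ] TangentSpace I x :=
  if hY : MDiffAt (T% Y) x then
    ∑ i, ((koszulForm hY).flip (stdOrthonormalBasis ℝ (TangentSpace I x) i)).smulRight
      (stdOrthonormalBasis ℝ (TangentSpace I x) i)
  else 0

theorem inner_leviCivitaFun {X Y Z : Π x : M, TangentSpace I x}
    (hX : MDiffAt (T% X) x) (hY : MDiffAt (T% Y) x) (hZ : MDiffAt (T% Z) x) :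
    inner ℝ (leviCivitaFun Y x (X x)) (Z x) = koszul I Y X Z x := by
  have key : koszulForm hY (X x) (Z x) = koszul I Y X Z x :=
    TensorialAt.mkHom₂_apply _ _ hX hZ
  rw [← key]
  conv_rhs => rw [← (stdOrthonormalBasis ℝ (TangentSpace I x)).sum_repr' (Z x)]
  simp [leviCivitaFun, hY, sum_inner, inner_smul_left, mul_comm]

theorem leviCivitaFun_ext {A B : TangentSpace I x →L[ℝ] TangentSpace I x}
    (h : ∀ X Z : Π x : M, TangentSpace I x, MDiffAt (T% X) x → MDiffAt (T% Z) x →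
      (inner ℝ (A (X x)) (Z x) : ℝ) = inner ℝ (B (X x)) (Z x)) : A = B := by
  ext1 u
  refine ext_inner_right ℝ fun w ↦ ?_
  simpa using h (extend E u) (extend E w) (mdifferentiableAt_extend ..)
    (mdifferentiableAt_extend ..)

variable (I M) in
/-- The Levi-Civita connection of the Riemannian metric; `leviCivita I M Y x (X x)` is
`(∇_X Y)(x)`. -/
def leviCivita : CovariantDerivative I E (fun x : M ↦ TangentSpace I x) where
  toFun := leviCivitaFun
  isCovariantDerivativeOnUniv :=
    { add := by
        intro Y Y' x hY hY' _
        refine leviCivitaFun_ext fun X Z hX hZ ↦ ?_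
        have hYY : MDiffAt (T% (Y + Y')) x := mdifferentiableAt_add_section hY hY'
        rw [inner_leviCivitaFun hX hYY hZ, add_apply, inner_add_left,
          inner_leviCivitaFun hX hY hZ, inner_leviCivitaFun hX hY' hZ]
        simp [koszul, mlieBracket_add_left hY hY', mlieBracket_add_right hY hY',
          inner_add_left, inner_add_right,
          mvfderiv_fun_add (mdifferentiableAt_metric hY hZ) (mdifferentiableAt_metric hY' hZ),
          mvfderiv_fun_add (mdifferentiableAt_metric hX hY) (mdifferentiableAt_metric hX hY')]
        ring
      leibniz := by
        intro Y f x hY hf _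
        refine leviCivitaFun_ext fun X Z hX hZ ↦ ?_
        have hfY : MDiffAt (T% (f • Y)) x := hf.smul_section hY
        rw [inner_leviCivitaFun hX hfY hZ, add_apply, inner_add_left,
          smul_apply, inner_smul_left, inner_leviCivitaFun hX hY hZ]
        simp [koszul, mlieBracket_smul_left hf hY, mlieBracket_smul_right hf hY,
          inner_add_left, inner_smul_left, inner_smul_right,
          mvfderiv_fun_mul hf (mdifferentiableAt_metric hY hZ),
          mvfderiv_fun_mul hf (mdifferentiableAt_metric hX hY)]
        rw [real_inner_comm (Y x) (X x)]
        ring }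

theorem inner_leviCivita {X Y Z : Π x : M, TangentSpace I x}
    (hX : MDiffAt (T% X) x) (hY : MDiffAt (T% Y) x) (hZ : MDiffAt (T% Z) x) :
    inner ℝ (leviCivita I M Y x (X x)) (Z x) = koszul I Y X Z x :=
  inner_leviCivitaFun hX hY hZ

theorem leviCivita_torsion : (leviCivita I M).torsion = 0 := by
  rw [CovariantDerivative.torsion_eq_zero_iff]
  intro X Y x hX hY
  refine ext_inner_right ℝ fun w ↦ ?_
  have hw : MDiffAt (T% (extend E w : Π x : M, TangentSpace I x)) x :=
    mdifferentiableAt_extend ..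
  have h1 := inner_leviCivita hX hY hw
  have h2 := inner_leviCivita hY hX hw
  rw [extend_apply_self] at h1 h2
  rw [inner_sub_left, h1, h2]
  simp only [koszul, extend_apply_self, real_inner_comm]
  rw [mlieBracket_swap_apply (V := Y) (W := X), mlieBracket_swap_apply (V := extend E w) (W := X),
    mlieBracket_swap_apply (V := extend E w) (W := Y)]
  simp only [inner_neg_right]
  ring

theorem leviCivita_isMetricCompatible :
    CovariantDerivative.IsMetricCompatible (V := fun x : M ↦ TangentSpace I x)
      (leviCivita I M) := by
  rw [CovariantDerivative.isMetricCompatible_iff]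
  intro x X Y Z hX hY hZ
  have h1 := inner_leviCivita hX hY hZ
  have h2 := inner_leviCivita hX hZ hY
  rw [real_inner_comm] at h2
  beta_reduce
  rw [h1, h2]
  simp only [koszul, real_inner_comm]
  rw [mlieBracket_swap_apply (V := Y) (W := X), mlieBracket_swap_apply (V := Z) (W := X),
    mlieBracket_swap_apply (V := Z) (W := Y)]
  simp only [inner_neg_right]
  ring

end LeviCivita

section Tensors

variable {E : Type*} [NormedAddCommGroup E] [NormedSpace ℝ E] [FiniteDimensional ℝ E]
  {H : Type*} [TopologicalSpace H] (I : ModelWithCorners ℝ E H)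
  {M : Type*} [TopologicalSpace M] [ChartedSpace H M] [IsManifold I 2 M]
  [RiemannianBundle (fun x : M ↦ TangentSpace I x)]
  [IsContMDiffRiemannianBundle I 1 E (fun x : M ↦ TangentSpace I x)]

/-- The curvature `R(X, Y)Z = ∇_X ∇_Y Z - ∇_Y ∇_X Z - ∇_[X, Y] Z` of the Levi-Civita connection. -/
def curvature (X Y Z : Π x : M, TangentSpace I x) (x : M) : TangentSpace I x :=
  leviCivita I M (fun p ↦ leviCivita I M Z p (Y p)) x (X x)
    - leviCivita I M (fun p ↦ leviCivita I M Z p (X p)) x (Y x)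
    - leviCivita I M Z x (mlieBracket I X Y x)

/-- The Ricci tensor `ρ(y, z) = ∑ᵢ g(R(eᵢ, y)z, eᵢ)`, the trace of `x ↦ R(x, y)z`, where `(eᵢ)` is
an orthonormal basis of the tangent space at `x`. The curvature is tensorial, so it is evaluated on
tangent vectors at `x` by extending them to vector fields which are smooth around `x`. -/
def ricci (x : M) (y z : TangentSpace I x) : ℝ :=
  ∑ i, inner ℝ
    (curvature I (extend E (stdOrthonormalBasis ℝ (TangentSpace I x) i)) (extend E y)
      (extend E z) x)
    (stdOrthonormalBasis ℝ (TangentSpace I x) i)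

/-- The Lie derivative of the metric,
`(L_v g)(X, Y) = v(g(X, Y)) - g([v, X], Y) - g(X, [v, Y])`. -/
def lieDerivMetric (v X Y : Π x : M, TangentSpace I x) (x : M) : ℝ :=
  d% (fun p ↦ inner ℝ (X p) (Y p)) x (v x)
    - inner ℝ (mlieBracket I v X x) (Y x) - inner ℝ (X x) (mlieBracket I v Y x)

end Tensors

section PiStructure

/-- The structure `(φ, ξ, η)` of a Riemannian `Π`-manifold on a smooth manifold `M` with Riemannian
metric `g`: a smooth (1,1)-tensor field `φ`, a smooth vector field `ξ` and a smooth 1-form `η`,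
forming an almost paracontact structure with `φ` traceless and `g` compatible with it. -/
structure RiemannianPiStructure {E : Type*} [NormedAddCommGroup E] [NormedSpace ℝ E]
    {H : Type*} [TopologicalSpace H] (I : ModelWithCorners ℝ E H)
    (M : Type*) [TopologicalSpace M] [ChartedSpace H M] [IsManifold I 1 M]
    [RiemannianBundle (fun x : M ↦ TangentSpace I x)] where
  φ : Π x : M, TangentSpace I x →L[ℝ] TangentSpace I x
  ξ : Π x : M, TangentSpace I x
  η : Π x : M, TangentSpace I x →L[ℝ] ℝ
  contMDiff_φ : ContMDiff I (I.prod 𝓘(ℝ, E →L[ℝ] E)) ∞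
    (fun x ↦ TotalSpace.mk' (E →L[ℝ] E)
      (E := fun x : M ↦ TangentSpace I x →L[ℝ] TangentSpace I x) x (φ x))
  contMDiff_ξ : CMDiff ∞ (T% ξ)
  contMDiff_η : ContMDiff I (I.prod 𝓘(ℝ, E →L[ℝ] ℝ)) ∞
    (fun x ↦ TotalSpace.mk' (E →L[ℝ] ℝ)
      (E := fun x : M ↦ TangentSpace I x →L[ℝ] Bundle.Trivial M ℝ x) x (η x))
  φ_ξ (x : M) : φ x (ξ x) = 0
  φ_φ (x : M) (y : TangentSpace I x) : φ x (φ x y) = y - η x y • ξ x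
  η_φ (x : M) (y : TangentSpace I x) : η x (φ x y) = 0
  η_ξ (x : M) : η x (ξ x) = 1
  trace_φ (x : M) : LinearMap.trace ℝ (TangentSpace I x) (φ x).toLinearMap = 0
  inner_φ_φ (x : M) (y z : TangentSpace I x) :
    (inner ℝ (φ x y) (φ x z) : ℝ) = inner ℝ y z - η x y * η x z

namespace RiemannianPiStructure

variable {E : Type*} [NormedAddCommGroup E] [NormedSpace ℝ E] [FiniteDimensional ℝ E]
  {H : Type*} [TopologicalSpace H] {I : ModelWithCorners ℝ E H}
  {M : Type*} [TopologicalSpace M] [ChartedSpace H M] [IsManifold I 2 M]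
  [RiemannianBundle (fun x : M ↦ TangentSpace I x)]
  [IsContMDiffRiemannianBundle I 1 E (fun x : M ↦ TangentSpace I x)]
  (S : RiemannianPiStructure I M)

/-- The associated metric `g̃(y, z) = g(y, φz) + η(y)η(z)`. -/
def assocMetric (x : M) (y z : TangentSpace I x) : ℝ :=
  inner ℝ y (S.φ x z) + S.η x y * S.η x z

/-- `(∇_y φ)Z = ∇_y(φZ) - φ(∇_y Z)` for a tangent vector `y` at `x` and a vector field `Z`. -/
def covDerivφ (Z : Π x : M, TangentSpace I x) (x : M) (y : TangentSpace I x) :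
    TangentSpace I x :=
  leviCivita I M (fun p ↦ S.φ p (Z p)) x y - S.φ x (leviCivita I M Z x y)

/-- The para-Sasaki-like condition
`(∇_y φ)z = -g(y, z)ξ - η(z)y + 2η(y)η(z)ξ`. -/
def IsParaSasakiLike : Prop :=
  ∀ (x : M) (y : TangentSpace I x) (Z : Π x : M, TangentSpace I x), MDiffAt (T% Z) x →
    S.covDerivφ Z x y =
      -(inner ℝ y (Z x) : ℝ) • S.ξ x - S.η x (Z x) • y
        + (2 * S.η x y * S.η x (Z x)) • S.ξ x

/-- Para-Ricci-like soliton with potential `v` and constants `(lam, mu, nu)`: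
`ρ = -½ L_v g - lam g - mu g̃ - nu η ⊗ η`. -/
def IsParaRicciLikeSoliton (v : Π x : M, TangentSpace I x) (lam mu nu : ℝ) : Prop :=
  ∀ (x : M) (Y Z : Π x : M, TangentSpace I x), MDiffAt (T% Y) x → MDiffAt (T% Z) x →
    ricci I x (Y x) (Z x) =
      -(1 / 2 : ℝ) * lieDerivMetric I v Y Z x - lam * inner ℝ (Y x) (Z x)
        - mu * S.assocMetric x (Y x) (Z x) - nu * (S.η x (Y x) * S.η x (Z x))

end RiemannianPiStructure

end PiStructure

end

section Algebra

variable {A L : Type*} [CommRing A] [LieRing L] [Module A L] [LieRingModule L A]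

section LieRinehart

variable [LieRinehartRing A L]

theorem lie_one_eq_zero (X : L) : ⁅X, (1 : A)⁆ = 0 := by
  have h := LieRinehartRing.leibniz_mul_right X (1 : A) 1
  simp only [mul_one, smul_eq_mul, one_mul] at h
  linear_combination -h

theorem lie_natCast_eq_zero (X : L) (n : ℕ) : ⁅X, (n : A)⁆ = 0 := by
  induction n with
  | zero => simp
  | succ n ih => rw [Nat.cast_succ, lie_add, ih, lie_one_eq_zero, add_zero]

theorem lie_mul_const (X : L) {c : A} (hc : ⁅X, c⁆ = 0) (a : A) : ⁅X, c * a⁆ = c * ⁅X, a⁆ := by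
  rw [LieRinehartRing.leibniz_mul_right, hc]; simp

theorem lie_mul_eq (X : L) (a b : A) : ⁅X, a * b⁆ = a * ⁅X, b⁆ + ⁅X, a⁆ * b := by
  rw [LieRinehartRing.leibniz_mul_right, smul_eq_mul]

theorem smul_lie_eq (a : A) (X Y : L) : ⁅a • X, Y⁆ = a • ⁅X, Y⁆ - ⁅Y, a⁆ • X := by
  rw [← lie_skew, LieRinehartRing.leibniz_smul_right, ← lie_skew X Y]
  module

/-- The trace of endomorphisms commutes with Lie derivatives. -/
theorem lie_trace [Module.Free A L] [Module.Finite A L] (V : L) (T T' : L →ₗ[A] L)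
    (h : ∀ X, T' X = ⁅V, T X⁆ - T ⁅V, X⁆) :
    ⁅V, LinearMap.trace A L T⁆ = LinearMap.trace A L T' := by
  classical
  let b := Module.Free.chooseBasis A L
  have lie_sum' : ∀ (s : Finset (Module.Free.ChooseBasisIndex A L)) (f : _ → A),
      ⁅V, ∑ i ∈ s, f i⁆ = ∑ i ∈ s, ⁅V, f i⁆ := fun s f ↦ by
    induction s using Finset.induction_on with
    | empty => simp
    | insert a s ha ih => rw [Finset.sum_insert ha, Finset.sum_insert ha, lie_add, ih]
  have lie_sumL : ∀ (s : Finset (Module.Free.ChooseBasisIndex A L)) (f : _ → L),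
      ⁅V, ∑ i ∈ s, f i⁆ = ∑ i ∈ s, ⁅V, f i⁆ := fun s f ↦ by
    induction s using Finset.induction_on with
    | empty => simp
    | insert a s ha ih => rw [Finset.sum_insert ha, Finset.sum_insert ha, lie_add, ih]
  have tr : ∀ S : L →ₗ[A] L, LinearMap.trace A L S = ∑ i, b.repr (S (b i)) i := fun S ↦ by
    rw [LinearMap.trace_eq_matrix_trace A b]
    simp [Matrix.trace, LinearMap.toMatrix_apply]
  have key : ∀ (X : L) i, b.repr ⁅V, X⁆ i =
      ⁅V, b.repr X i⁆ + ∑ j, b.repr X j * b.repr ⁅V, b j⁆ i := by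
    intro X i
    conv_lhs => rw [← b.sum_repr X]
    rw [lie_sumL]
    simp only [LieRinehartRing.leibniz_smul_right, map_sum, map_add, map_smul,
      Finsupp.coe_finsetSum, Finset.sum_apply, Finsupp.add_apply, Finsupp.smul_apply, smul_eq_mul,
      Finset.sum_add_distrib, b.repr_self]
    rw [add_comm]
    congr 1
    rw [Finset.sum_eq_single i] <;> simp +contextual
  have hT : ∀ i j, b.repr (T ⁅V, b j⁆) i = ∑ k, b.repr ⁅V, b j⁆ k * b.repr (T (b k)) i := by
    intro i j
    conv_lhs => rw [← b.sum_repr ⁅V, b j⁆]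
    simp only [map_sum, map_smul, Finsupp.coe_finsetSum, Finset.sum_apply, Finsupp.smul_apply,
      smul_eq_mul]
  rw [tr, tr, lie_sum']
  simp only [h, map_sub, Finsupp.sub_apply, key (T _), hT, Finset.sum_sub_distrib,
    Finset.sum_add_distrib]
  rw [Finset.sum_comm]
  simp [mul_comm]

end LieRinehart

variable (A L) in
/-- The algebraic data of a para-Sasaki-like Riemannian `Π`-manifold over a Lie-Rinehart pair:
a nondegenerate metric `g`, a metric torsion-free connection, and the structure `(φ, ξ, η)`. -/
structure ParaSasakiLikeData (n : ℕ) where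
  g : L →ₗ[A] L →ₗ[A] A
  conn : L →ₗ[A] L →+ L
  φ : L →ₗ[A] L
  ξ : L
  η : L →ₗ[A] A
  g_symm (X Y : L) : g X Y = g Y X
  g_nondeg (X : L) (h : ∀ Y, g X Y = 0) : X = 0
  conn_smul (X : L) (a : A) (Y : L) : conn X (a • Y) = a • conn X Y + ⁅X, a⁆ • Y
  conn_torsion (X Y : L) : conn X Y - conn Y X = ⁅X, Y⁆
  conn_metric (X Y Z : L) : ⁅X, g Y Z⁆ = g (conn X Y) Z + g Y (conn X Z)
  φ_ξ : φ ξ = 0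
  φ_φ (X : L) : φ (φ X) = X - η X • ξ
  η_φ (X : L) : η (φ X) = 0
  η_ξ : η ξ = 1
  g_φ_φ (X Y : L) : g (φ X) (φ Y) = g X Y - η X * η Y
  trace_φ : LinearMap.trace A L φ = 0
  trace_id : LinearMap.trace A L LinearMap.id = 2 * n + 1
  conn_φ (X Y : L) :
    conn X (φ Y) = φ (conn X Y) - g X Y • ξ - η Y • X + (2 * η X * η Y) • ξ

namespace ParaSasakiLikeData

variable {n : ℕ} (S : ParaSasakiLikeData A L n)

/-- The same data for the structure `(-φ, -ξ, -η)`. -/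
@[simps] def neg : ParaSasakiLikeData A L n where
  g := S.g
  conn := S.conn
  φ := -S.φ
  ξ := -S.ξ
  η := -S.η
  g_symm := S.g_symm
  g_nondeg := S.g_nondeg
  conn_smul := S.conn_smul
  conn_torsion := S.conn_torsion
  conn_metric := S.conn_metric
  φ_ξ := by simp [S.φ_ξ]
  φ_φ X := by simp [S.φ_φ]
  η_φ X := by simp [S.η_φ]
  η_ξ := by simp [S.η_ξ]
  g_φ_φ X Y := by simp [S.g_φ_φ]
  trace_φ := by simp [S.trace_φ]
  trace_id := S.trace_id
  conn_φ X Y := by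
    simp only [LinearMap.neg_apply, map_neg, S.conn_φ]
    module

theorem g_ξ (X : L) : S.g X S.ξ = S.η X := by
  have h := S.g_φ_φ X S.ξ
  rw [S.φ_ξ, S.η_ξ, map_zero] at h
  linear_combination -h

theorem ξ_g (X : L) : S.g S.ξ X = S.η X := by rw [S.g_symm, S.g_ξ]

theorem g_φ_left (X Y : L) : S.g (S.φ X) Y = S.g X (S.φ Y) := by
  have h := S.g_φ_φ X (S.φ Y)
  rw [S.φ_φ, S.η_φ, map_sub, map_smul, S.g_ξ, S.η_φ, smul_zero] at h
  linear_combination h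

theorem g_ext {X Y : L} (h : ∀ Z, S.g X Z = S.g Y Z) : X = Y :=
  sub_eq_zero.mp <| S.g_nondeg _ fun Z ↦ by simp [h]

section

variable [LieRinehartRing A L]

section Torsion

variable [IsAddTorsionFree A]

theorem _root_.eq_zero_of_two_mul {a : A} (h : 2 * a = 0) : a = 0 := by
  refine IsAddTorsionFree.nsmul_right_injective (two_ne_zero) ?_
  simpa [two_mul, two_nsmul] using h

theorem conn_ξ (X : L) : S.conn X S.ξ = S.φ X := by
  have h := S.conn_φ X S.ξ
  rw [S.φ_ξ, map_zero, S.η_ξ, S.g_ξ] at h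
  have h1 : S.φ (S.conn X S.ξ) = S.φ (S.φ X) := by
    rw [S.φ_φ]
    linear_combination (norm := module) -h
  have h2 := congrArg S.φ h1
  have h3 : S.η (S.conn X S.ξ) = 0 := by
    have := S.conn_metric X S.ξ S.ξ
    rw [S.g_ξ, S.g_ξ, S.ξ_g, S.η_ξ, lie_one_eq_zero] at this
    refine eq_zero_of_two_mul ?_
    linear_combination -this
  rw [S.φ_φ, S.φ_φ, h3, S.η_φ] at h2
  simpa using h2

theorem lie_η (X Y : L) : ⁅X, S.η Y⁆ = S.η (S.conn X Y) + S.g (S.φ X) Y := by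
  rw [← S.g_ξ, S.conn_metric, S.conn_ξ, S.g_ξ, S.g_symm Y]

/-- The form `η` is closed. -/
theorem lie_η_sub (X Y : L) : ⁅X, S.η Y⁆ - ⁅Y, S.η X⁆ = S.η ⁅X, Y⁆ := by
  rw [S.lie_η, S.lie_η, ← S.conn_torsion, map_sub, S.g_φ_left X, S.g_symm X]
  ring

theorem conn_ξ_φ (X : L) : S.conn S.ξ (S.φ X) = S.φ (S.conn S.ξ X) := by
  rw [S.conn_φ, S.η_ξ, S.ξ_g]
  module

theorem lie_ξ (X : L) : ⁅S.ξ, X⁆ = S.conn S.ξ X - S.φ X := by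
  rw [← S.conn_torsion, S.conn_ξ]

theorem lie_ξ_φ (X : L) : ⁅S.ξ, S.φ X⁆ = S.φ ⁅S.ξ, X⁆ := by
  rw [S.lie_ξ, S.lie_ξ, S.conn_ξ_φ, map_sub]

theorem η_lie_ξ (X : L) : S.η ⁅S.ξ, X⁆ = ⁅S.ξ, S.η X⁆ := by
  rw [← S.lie_η_sub, S.η_ξ, lie_one_eq_zero, sub_zero]

end Torsion

/-- The Lie derivative of the metric `g` along `V`. -/
def lieG (V X Y : L) : A := ⁅V, S.g X Y⁆ - S.g ⁅V, X⁆ Y - S.g X ⁅V, Y⁆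

theorem lieG_eq (V X Y : L) : S.lieG V X Y = S.g (S.conn X V) Y + S.g X (S.conn Y V) := by
  rw [lieG, S.conn_metric, ← S.conn_torsion, ← S.conn_torsion]
  simp only [map_sub, LinearMap.sub_apply]
  ring

theorem lieG_symm (V X Y : L) : S.lieG V X Y = S.lieG V Y X := by
  rw [lieG, lieG, S.g_symm X Y, S.g_symm _ Y, S.g_symm X]; ring

theorem lieG_add_left (V X X' Y : L) : S.lieG V (X + X') Y = S.lieG V X Y + S.lieG V X' Y := by
  simp only [lieG_eq, map_add, LinearMap.add_apply, AddMonoidHom.add_apply]; ring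

theorem lieG_smul_left (a : A) (V X Y : L) : S.lieG V (a • X) Y = a * S.lieG V X Y := by
  simp only [lieG_eq, map_smul, LinearMap.smul_apply, AddMonoidHom.smul_apply, smul_eq_mul]; ring

theorem lieG_sub_left (V X X' Y : L) : S.lieG V (X - X') Y = S.lieG V X Y - S.lieG V X' Y := by
  simp only [lieG_eq, map_sub, LinearMap.sub_apply, AddMonoidHom.sub_apply]; ring

theorem lieG_add_field (V V' X Y : L) : S.lieG (V + V') X Y = S.lieG V X Y + S.lieG V' X Y := by
  simp only [lieG_eq, map_add, LinearMap.add_apply]; ring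

/-- The commutator of two Lie derivatives of the metric. -/
theorem lieG_lie (V W X Y : L) :
    S.lieG ⁅V, W⁆ X Y =
      (⁅V, S.lieG W X Y⁆ - S.lieG W ⁅V, X⁆ Y - S.lieG W X ⁅V, Y⁆)
        - (⁅W, S.lieG V X Y⁆ - S.lieG V ⁅W, X⁆ Y - S.lieG V X ⁅W, Y⁆) := by
  simp only [lieG, lie_sub, lie_lie, map_sub, LinearMap.sub_apply]
  ring

variable [IsAddTorsionFree A]

theorem lieG_ξ (X Y : L) : S.lieG S.ξ X Y = 2 * S.g (S.φ X) Y := by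
  rw [lieG_eq, S.conn_ξ, S.conn_ξ, ← S.g_φ_left]; ring

/-- The curvature tensor. -/
def curv (X Y Z : L) : L :=
  S.conn X (S.conn Y Z) - S.conn Y (S.conn X Z) - S.conn ⁅X, Y⁆ Z

/-- The map `X ↦ R(X, Y)Z`. -/
def curvMap (Y Z : L) : L →ₗ[A] L where
  toFun X := S.curv X Y Z
  map_add' X X' := by
    simp only [curv, map_add, AddMonoidHom.add_apply, add_lie]; abel
  map_smul' a X := by
    simp only [curv, map_smul, map_sub, AddMonoidHom.smul_apply, smul_lie_eq, S.conn_smul,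
      AddMonoidHom.sub_apply, RingHom.id_apply]
    module

/-- The Ricci tensor. -/
noncomputable def ric (Y Z : L) : A := LinearMap.trace A L (S.curvMap Y Z)

theorem curv_ξ (X Y : L) : S.curv X Y S.ξ = S.η X • Y - S.η Y • X := by
  simp only [curv, S.conn_ξ, S.conn_φ, ← S.conn_torsion, map_sub, S.g_symm Y X,
    AddMonoidHom.sub_apply]
  module

variable [Module.Free A L] [Module.Finite A L]

theorem ric_ξ (Y : L) : S.ric Y S.ξ = -(2 * n) * S.η Y := by
  have : S.curvMap Y S.ξ = S.η.smulRight Y - S.η Y • LinearMap.id := by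
    ext X
    simpa using! S.curv_ξ X Y
  rw [ric, this, map_sub, map_smul, S.trace_id, LinearMap.trace_smulRight]
  simp only [smul_eq_mul]
  ring

/-- The Lie derivative of the Levi-Civita connection along `ξ`. -/
theorem lie_ξ_conn (X Y : L) :
    ⁅S.ξ, S.conn X Y⁆ = S.conn ⁅S.ξ, X⁆ Y + S.conn X ⁅S.ξ, Y⁆
      - (2 * (S.g X Y - S.η X * S.η Y)) • S.ξ := by
  set B : L → L → L := fun X Y ↦ ⁅S.ξ, S.conn X Y⁆ - S.conn ⁅S.ξ, X⁆ Y - S.conn X ⁅S.ξ, Y⁆ with hB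
  have B_symm : ∀ X Y, B X Y = B Y X := by
    intro X Y
    rw [← sub_eq_zero]
    have h1 : ⁅S.ξ, S.conn X Y⁆ - ⁅S.ξ, S.conn Y X⁆ = ⁅S.ξ, ⁅X, Y⁆⁆ := by
      rw [← lie_sub, S.conn_torsion]
    have h2 := S.conn_torsion ⁅S.ξ, X⁆ Y
    have h3 := S.conn_torsion X ⁅S.ξ, Y⁆
    have h4 := leibniz_lie S.ξ X Y
    simp only [hB]
    linear_combination (norm := module) h1 - h2 - h3 + h4
  have B_metric : ∀ X Y Z, S.g (B X Y) Z + S.g Y (B X Z) =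
      2 * (- S.g X Y * S.η Z - S.η Y * S.g X Z + 2 * S.η X * S.η Y * S.η Z) := by
    intro X Y Z
    have K : ∀ Y Z, ⁅S.ξ, S.g Y Z⁆ = S.g ⁅S.ξ, Y⁆ Z + S.g Y ⁅S.ξ, Z⁆ + 2 * S.g (S.φ Y) Z := by
      intro Y Z
      rw [← S.lieG_ξ, lieG]; ring
    have two : ∀ X : L, ⁅X, (2 : A)⁆ = 0 := fun X ↦ by simpa using lie_natCast_eq_zero (A := A) X 2
    have h1 := congrArg (fun a ↦ ⁅S.ξ, a⁆) (S.conn_metric X Y Z)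
    rw [lie_add, K (S.conn X Y), K Y (S.conn X Z)] at h1
    have h2 := congrArg (fun a ↦ ⁅X, a⁆) (K Y Z)
    rw [lie_add, lie_add, lie_mul_const X (two X), S.conn_metric X ⁅S.ξ, Y⁆,
      S.conn_metric X Y ⁅S.ξ, Z⁆, S.conn_metric X (S.φ Y), S.conn_φ] at h2
    have h3 := S.conn_metric ⁅S.ξ, X⁆ Y Z
    rw [lie_lie] at h3
    simp only [hB, map_sub, map_add, map_smul, LinearMap.sub_apply, LinearMap.add_apply,
      LinearMap.smul_apply, S.ξ_g, smul_eq_mul] at h1 h2 h3 ⊢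
    linear_combination h2 - h1 + h3
  have B_eq : B X Y = -((2 * (S.g X Y - S.η X * S.η Y)) • S.ξ) := by
    refine S.g_ext fun Z ↦ ?_
    rw [← sub_eq_zero]
    refine eq_zero_of_two_mul ?_
    have h1 := B_metric X Y Z
    have h2 := B_metric Y X Z
    have h3 := B_metric Z X Y
    rw [B_symm Y X] at h2
    rw [B_symm Z X, B_symm Z Y, S.g_symm _ Y, S.g_symm Z X, S.g_symm Z Y] at h3
    rw [S.g_symm Y X] at h2
    simp only [map_neg, map_smul, LinearMap.neg_apply, LinearMap.smul_apply, S.ξ_g, smul_eq_mul]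
    linear_combination h1 + h2 - h3
  simp only [hB] at B_eq
  linear_combination (norm := module) B_eq

/-- The Lie derivative of the curvature along `ξ`. -/
theorem lie_ξ_curv (X Y Z : L) :
    ⁅S.ξ, S.curv X Y Z⁆ = S.curv ⁅S.ξ, X⁆ Y Z + S.curv X ⁅S.ξ, Y⁆ Z + S.curv X Y ⁅S.ξ, Z⁆
      + (2 * (S.η Y * S.g (S.φ X) Z - S.η X * S.g (S.φ Y) Z)) • S.ξ
      - (2 * (S.g Y Z - S.η Y * S.η Z)) • S.φ X + (2 * (S.g X Z - S.η X * S.η Z)) • S.φ Y := by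
  have two : ∀ X : L, ⁅X, (2 : A)⁆ = 0 := fun X ↦ by simpa using lie_natCast_eq_zero (A := A) X 2
  have hg : S.g ⁅X, Y⁆ Z = S.g (S.conn X Y) Z - S.g (S.conn Y X) Z := by
    rw [← S.conn_torsion, map_sub, LinearMap.sub_apply]
  have hη : S.η ⁅X, Y⁆ = S.η (S.conn X Y) - S.η (S.conn Y X) := by
    rw [← S.conn_torsion, map_sub]
  simp only [curv, lie_sub, S.lie_ξ_conn, map_sub, map_add, S.conn_smul, S.conn_ξ,
    lie_mul_const _ (two _), lie_mul_eq, S.lie_η, S.conn_metric, leibniz_lie S.ξ X Y, hg, hη,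
    AddMonoidHom.add_apply, S.g_symm (S.φ Y) X, ← S.g_φ_left X Y]
  module

/-- The Ricci tensor is invariant under `ξ`. -/
theorem lie_ξ_ric (Y Z : L) :
    ⁅S.ξ, S.ric Y Z⁆ = S.ric ⁅S.ξ, Y⁆ Z + S.ric Y ⁅S.ξ, Z⁆ := by
  have h := lie_trace S.ξ (S.curvMap Y Z)
    (S.curvMap ⁅S.ξ, Y⁆ Z + S.curvMap Y ⁅S.ξ, Z⁆
      + ((2 * S.η Y) • ((S.g.flip Z) ∘ₗ S.φ) - (2 * S.g (S.φ Y) Z) • S.η).smulRight S.ξ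
      - (2 * (S.g Y Z - S.η Y * S.η Z)) • S.φ
      + ((2 : A) • (S.g.flip Z - S.η Z • S.η)).smulRight (S.φ Y)) fun X ↦ by
    simp only [LinearMap.add_apply, LinearMap.sub_apply, LinearMap.smulRight_apply,
      LinearMap.smul_apply, LinearMap.comp_apply, LinearMap.flip_apply, smul_eq_mul, curvMap,
      LinearMap.coe_mk, AddHom.coe_mk, S.lie_ξ_curv X Y Z]
    module
  simp only [map_add, map_sub, map_smul, LinearMap.trace_smulRight, S.trace_φ,
    LinearMap.sub_apply, LinearMap.smul_apply, LinearMap.comp_apply, LinearMap.flip_apply, S.φ_ξ,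
    S.η_ξ, S.η_φ, map_zero, smul_eq_mul] at h
  rw [ric, h, ric, ric]
  ring

end

end ParaSasakiLikeData

end Algebra

section AlgebraicSoliton

variable {A L : Type*} [CommRing A] [LieRing L] [Module A L] [LieRingModule L A]
  [LieRinehartRing A L] [IsAddTorsionFree A] [Module.Free A L] [Module.Finite A L]

namespace ParaSasakiLikeData

variable {n : ℕ} (S : ParaSasakiLikeData A L n)

theorem η_eq_zero {X : L} (hX : S.φ X = X) : S.η X = 0 := by
  rw [← hX, S.η_φ]

theorem η_eq_zero' {X : L} (hX : S.φ X = -X) : S.η X = 0 := by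
  have := S.η_φ X
  rwa [hX, map_neg, neg_eq_zero] at this

theorem φ_lie_ξ {X : L} (hX : S.φ X = X) : S.φ ⁅S.ξ, X⁆ = ⁅S.ξ, X⁆ := by
  rw [← S.lie_ξ_φ, hX]

theorem φ_lie_ξ' {X : L} (hX : S.φ X = -X) : S.φ ⁅S.ξ, X⁆ = -⁅S.ξ, X⁆ := by
  rw [← S.lie_ξ_φ, hX, lie_neg]

theorem g_eq_zero {X Y : L} (hX : S.φ X = X) (hY : S.φ Y = -Y) : S.g X Y = 0 := by
  have h := S.g_φ_left X Y
  rw [hX, hY, map_neg] at h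
  exact eq_zero_of_two_mul (by linear_combination h)

theorem φ_proj (X : L) : S.φ (S.φ (S.φ X) + S.φ X) = S.φ (S.φ X) + S.φ X := by
  rw [map_add, S.φ_φ (S.φ X), S.η_φ, zero_smul, sub_zero, add_comm]

theorem φ_proj' (X : L) : S.φ (S.φ (S.φ X) - S.φ X) = -(S.φ (S.φ X) - S.φ X) := by
  rw [map_sub, S.φ_φ (S.φ X), S.η_φ, zero_smul, sub_zero, neg_sub]

/-- The `+1`-eigendistribution of `φ` is not degenerate. -/
theorem eq_zero_of_mul_g (hn : n ≠ 0) {a : A}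
    (h : ∀ X Y, S.φ X = X → S.φ Y = Y → a * S.g X Y = 0) : a = 0 := by
  have h1 : a • (LinearMap.id - S.η.smulRight S.ξ + S.φ) = 0 := by
    ext X
    refine S.g_nondeg _ fun Y ↦ eq_zero_of_two_mul ?_
    have h2 := h _ _ (S.φ_proj X) (S.φ_proj Y)
    rw [map_add, ← S.g_φ_left _ (S.φ Y), S.φ_proj, ← S.g_φ_left _ Y, S.φ_proj] at h2
    simp only [LinearMap.smul_apply, LinearMap.add_apply, LinearMap.sub_apply, LinearMap.id_apply,
      LinearMap.smulRight_apply, ← S.φ_φ, map_smul, smul_eq_mul]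
    linear_combination h2
  have h3 := congrArg (LinearMap.trace A L) h1
  rw [map_smul, map_add, map_sub, S.trace_φ, S.trace_id, LinearMap.trace_smulRight, S.η_ξ,
    map_zero, smul_eq_mul] at h3
  refine IsAddTorsionFree.nsmul_right_injective hn ?_
  simp only [nsmul_eq_mul, mul_zero]
  exact eq_zero_of_two_mul (by linear_combination h3)

theorem conn_φ_of_ne {X Y : L} (hX : S.φ X = X) (hY : S.φ Y = -Y) :
    S.φ (S.conn X Y) = -S.conn X Y := by
  have h := S.conn_φ X Y
  rw [hY, S.g_eq_zero hX hY, S.η_eq_zero hX, S.η_eq_zero' hY, map_neg] at h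
  linear_combination (norm := module) -h

theorem conn_φ_of_ne' {X Y : L} (hX : S.φ X = -X) (hY : S.φ Y = Y) :
    S.φ (S.conn X Y) = S.conn X Y := by
  have h := S.conn_φ X Y
  rw [hY, S.g_symm, S.g_eq_zero hY hX, S.η_eq_zero' hX, S.η_eq_zero hY] at h
  linear_combination (norm := module) -h

theorem lie_ξ_g (X Y : L) :
    ⁅S.ξ, S.g X Y⁆ = S.g ⁅S.ξ, X⁆ Y + S.g X ⁅S.ξ, Y⁆ + 2 * S.g (S.φ X) Y := by
  rw [← S.lieG_ξ, lieG]; ring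

/-- The algebraic para-Ricci-like soliton equation with potential `v` and constants `l`, `m` and
`2 * n - c - l`. -/
structure IsSoliton (v : L) (l m c : A) : Prop where
  lie_l (X : L) : ⁅X, l⁆ = 0
  lie_m (X : L) : ⁅X, m⁆ = 0
  lie_c (X : L) : ⁅X, c⁆ = 0
  two_ric (X Y : L) : 2 * S.ric X Y = -S.lieG v X Y
    - 2 * (l * S.g X Y + m * S.g X (S.φ Y) + (2 * n - c - l) * (S.η X * S.η Y))

namespace IsSoliton

variable {S} {v : L} {l m c : A}

theorem neg (h : S.IsSoliton v l m c) : S.neg.IsSoliton v l (-m) c where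
  lie_l := h.lie_l
  lie_m X := by rw [lie_neg, h.lie_m, neg_zero]
  lie_c := h.lie_c
  two_ric X Y := by
    have := h.two_ric X Y
    have h1 : S.neg.ric X Y = S.ric X Y := rfl
    have h2 : S.neg.lieG v X Y = S.lieG v X Y := rfl
    simp only [neg_g, neg_φ, neg_η, LinearMap.neg_apply, map_neg, h1, h2]
    linear_combination this

theorem lieG_ξ (h : S.IsSoliton v l m c) (X : L) : S.lieG v X S.ξ = 2 * c * S.η X := by
  have := h.two_ric X S.ξ
  rw [S.ric_ξ, S.g_ξ, S.φ_ξ, S.η_ξ, map_zero] at this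
  linear_combination this

theorem lieG_eigen (h : S.IsSoliton v l m c) {X Y : L} (hX : S.φ X = X) (hY : S.φ Y = Y) :
    S.lieG v X Y = -2 * S.ric X Y - 2 * (l + m) * S.g X Y := by
  have := h.two_ric X Y
  rw [S.η_eq_zero hX, hY] at this
  linear_combination this

theorem lieG_mixed (h : S.IsSoliton v l m c) {X Y : L} (hX : S.φ X = X) (hY : S.φ Y = -Y) :
    S.lieG v X Y = -2 * S.ric X Y := by
  have := h.two_ric X Y
  rw [S.η_eq_zero hX, hY, map_neg, S.g_eq_zero hX hY] at this
  linear_combination this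

theorem η_lie (h : S.IsSoliton v l m c) : S.η ⁅S.ξ, v⁆ = c := by
  have h1 := h.lieG_ξ S.ξ
  rw [lieG, S.g_ξ, S.g_ξ, S.ξ_g, S.η_ξ, lie_one_eq_zero, ← lie_skew, map_neg] at h1
  rw [← sub_eq_zero]
  exact eq_zero_of_two_mul (by linear_combination h1)

theorem g_lie (h : S.IsSoliton v l m c) (X : L) :
    S.g ⁅S.ξ, v⁆ X = 2 * c * S.η X - ⁅X, S.η v⁆ := by
  have h1 := h.lieG_ξ X
  have h2 := S.lie_η_sub v X
  rw [lieG, S.g_ξ, S.g_ξ, ← lie_skew v S.ξ, map_neg, S.g_symm X] at h1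
  linear_combination h1 - h2

theorem lie_lie_ξ (h : S.IsSoliton v l m c) : ⁅S.ξ, ⁅S.ξ, v⁆⁆ = -(S.φ ⁅S.ξ, v⁆ + S.φ ⁅S.ξ, v⁆) := by
  refine S.g_ext fun X ↦ ?_
  have two : ⁅S.ξ, (2 : A)⁆ = 0 := by simpa using lie_natCast_eq_zero (A := A) S.ξ 2
  have h1 := S.lie_ξ_g ⁅S.ξ, v⁆ X
  have h2 := lie_lie S.ξ X (S.η v)
  rw [← S.η_lie_ξ, h.η_lie, h.lie_c] at h2
  rw [h.g_lie X, h.g_lie ⁅S.ξ, X⁆, S.η_lie_ξ, lie_sub, mul_assoc, lie_mul_const _ two,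
    lie_mul_const _ (h.lie_c _)] at h1
  simp only [map_neg, map_add, LinearMap.neg_apply, LinearMap.add_apply]
  linear_combination -h1 + h2

theorem lieG_lie_ξ (h : S.IsSoliton v l m c) {X Y : L} (hX : S.φ X = X) (hY : S.φ Y = Y) :
    S.lieG ⁅S.ξ, v⁆ X Y = 4 * S.ric X Y := by
  have two : ∀ X : L, ⁅X, (2 : A)⁆ = 0 := fun X ↦ by simpa using lie_natCast_eq_zero (A := A) X 2
  have hlm : ⁅S.ξ, 2 * (l + m)⁆ = 0 := by
    rw [lie_mul_const _ (two _), lie_add, h.lie_l, h.lie_m]; ring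
  have h2 : ⁅S.ξ, (-2 : A)⁆ = 0 := by rw [lie_neg, two, neg_zero]
  have hlv := h.lieG_eigen hX hY
  rw [lieG] at hlv
  rw [lieG_lie, h.lieG_eigen hX hY, h.lieG_eigen (S.φ_lie_ξ hX) hY,
    h.lieG_eigen hX (S.φ_lie_ξ hY), lie_sub, lie_mul_const _ hlm, lie_mul_const _ h2,
    S.lie_ξ_ric, S.lie_ξ_g, S.lieG_ξ, S.lieG_ξ, S.lieG_ξ, lie_mul_const _ (two _),
    S.g_φ_left ⁅v, X⁆, hX, hY]
  linear_combination -2 * hlv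

theorem lieG_φ_lie_ξ (h : S.IsSoliton v l m c) {X Y : L} (hX : S.φ X = X) (hY : S.φ Y = Y) :
    S.lieG (S.φ ⁅S.ξ, v⁆) X Y = S.lieG ⁅S.ξ, v⁆ X Y - 2 * c * S.g X Y := by
  rw [lieG_eq, lieG_eq, S.conn_φ, S.conn_φ, h.η_lie]
  simp only [map_sub, map_add, map_smul, LinearMap.sub_apply, LinearMap.add_apply,
    LinearMap.smul_apply, S.ξ_g, S.g_ξ, S.η_eq_zero hX, S.η_eq_zero hY, S.g_φ_left _ Y,
    ← S.g_φ_left X, hX, hY, smul_eq_mul]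
  ring

theorem const_eq_zero (h : S.IsSoliton v l m c) (hn : n ≠ 0) : c = 0 := by
  refine S.eq_zero_of_mul_g hn fun X Y hX hY ↦ ?_
  have four : ∀ X : L, ⁅X, (4 : A)⁆ = 0 := fun X ↦ by simpa using lie_natCast_eq_zero (A := A) X 4
  have two : ∀ X : L, ⁅X, (2 : A)⁆ = 0 := fun X ↦ by simpa using lie_natCast_eq_zero (A := A) X 2
  have h1 := S.lieG_lie S.ξ ⁅S.ξ, v⁆ X Y
  have hneg : ∀ V : L, S.lieG (-V) X Y = -S.lieG V X Y := fun V ↦ by simp [lieG_eq]; ring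
  have hw := h.lieG_lie_ξ hX hY
  rw [lieG] at hw
  rw [h.lie_lie_ξ, hneg, lieG_add_field, h.lieG_φ_lie_ξ hX hY, h.lieG_lie_ξ hX hY,
    h.lieG_lie_ξ (S.φ_lie_ξ hX) hY, h.lieG_lie_ξ hX (S.φ_lie_ξ hY), lie_mul_const _ (four _),
    S.lie_ξ_ric, S.lieG_ξ, S.lieG_ξ, S.lieG_ξ, lie_mul_const _ (two _),
    S.g_φ_left ⁅⁅S.ξ, v⁆, X⁆, hX, hY] at h1
  refine eq_zero_of_two_mul (eq_zero_of_two_mul ?_)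
  linear_combination h1 - 2 * hw

theorem lieG_φ_lie_ξ_mixed (h : S.IsSoliton v l m 0) {X Y : L} (hX : S.φ X = X)
    (hY : S.φ Y = -Y) : S.lieG (S.φ ⁅S.ξ, v⁆) X Y = 0 := by
  have h1 := S.conn_metric X ⁅S.ξ, v⁆ Y
  have h2 := S.conn_metric Y ⁅S.ξ, v⁆ X
  have h3 := h.g_lie ⁅X, Y⁆
  rw [lie_lie] at h3
  rw [h.g_lie] at h1 h2
  rw [← S.conn_torsion X Y] at h3
  rw [lieG_eq, S.conn_φ, S.conn_φ, h.η_lie]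
  simp only [map_sub, map_add, map_smul, map_neg, LinearMap.sub_apply, LinearMap.add_apply,
    LinearMap.smul_apply, S.ξ_g, S.g_ξ, S.η_eq_zero hX, S.η_eq_zero' hY, S.g_φ_left _ Y,
    ← S.g_φ_left X, hX, hY, smul_eq_mul, mul_zero, zero_mul, zero_sub, lie_neg] at h1 h2 h3 ⊢
  rw [S.g_symm X (S.conn Y _)]
  linear_combination h1 - h2 + h3

variable (S v) in
/-- A modification of the potential commuting with `ξ`. -/
def aux : L := v + v + S.φ ⁅S.ξ, v⁆

theorem lie_ξ_aux (h : S.IsSoliton v l m 0) : ⁅S.ξ, aux S v⁆ = 0 := by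
  rw [aux, lie_add, lie_add, S.lie_ξ_φ, h.lie_lie_ξ, map_neg, map_add, S.φ_φ, h.η_lie]
  module

theorem lieG_aux_eigen (h : S.IsSoliton v l m 0) {X Y : L} (hX : S.φ X = X) (hY : S.φ Y = Y) :
    S.lieG (aux S v) X Y = -4 * (l + m) * S.g X Y := by
  rw [aux, lieG_add_field, lieG_add_field, h.lieG_φ_lie_ξ hX hY, h.lieG_lie_ξ hX hY,
    h.lieG_eigen hX hY]
  ring

theorem lieG_aux_mixed_ric (h : S.IsSoliton v l m 0) {X Y : L} (hX : S.φ X = X)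
    (hY : S.φ Y = -Y) : S.lieG (aux S v) X Y = -4 * S.ric X Y := by
  rw [aux, lieG_add_field, lieG_add_field, h.lieG_φ_lie_ξ_mixed hX hY, h.lieG_mixed hX hY]
  ring

theorem lie_aux_mixed (h : S.IsSoliton v l m 0) {X Y : L} (hX : S.φ X = X) (hY : S.φ Y = -Y) :
    S.g ⁅aux S v, X⁆ Y = 0 ∧ S.g X ⁅aux S v, Y⁆ = 0 ∧ S.lieG (aux S v) X Y = 0 := by
  set u := aux S v with hu
  have four : ⁅S.ξ, (4 : A)⁆ = 0 := by simpa using lie_natCast_eq_zero (A := A) S.ξ 4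
  have two : ⁅S.ξ, (2 : A)⁆ = 0 := by simpa using lie_natCast_eq_zero (A := A) S.ξ 2
  have comm : ∀ X : L, ⁅S.ξ, ⁅u, X⁆⁆ = ⁅u, ⁅S.ξ, X⁆⁆ := fun X ↦ by
    rw [leibniz_lie S.ξ, hu, h.lie_ξ_aux, zero_lie, zero_add]
  have hsum : ∀ {X Y : L}, S.φ X = X → S.φ Y = -Y →
      S.g ⁅u, X⁆ Y + S.g X ⁅u, Y⁆ = 4 * S.ric X Y := fun {X Y} hX hY ↦ by
    have h1 := h.lieG_aux_mixed_ric hX hY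
    rw [lieG, S.g_eq_zero hX hY, lie_zero] at h1
    linear_combination -h1
  have hα : ∀ {X Y : L}, S.φ X = X → S.φ Y = -Y →
      ⁅S.ξ, S.g ⁅u, X⁆ Y⁆ = S.g ⁅u, ⁅S.ξ, X⁆⁆ Y + S.g ⁅u, X⁆ ⁅S.ξ, Y⁆ - 2 * S.g ⁅u, X⁆ Y :=
    fun {X Y} hX hY ↦ by
      rw [S.lie_ξ_g, comm, S.g_φ_left, hY, map_neg]; ring
  have hβ : ∀ {X Y : L}, S.φ X = X → S.φ Y = -Y →
      ⁅S.ξ, S.g X ⁅u, Y⁆⁆ = S.g ⁅S.ξ, X⁆ ⁅u, Y⁆ + S.g X ⁅u, ⁅S.ξ, Y⁆⁆ + 2 * S.g X ⁅u, Y⁆ :=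
    fun {X Y} hX hY ↦ by
      rw [S.lie_ξ_g, comm, hX]
  have heq : ∀ {X Y : L}, S.φ X = X → S.φ Y = -Y → S.g ⁅u, X⁆ Y = 2 * S.ric X Y := by
    intro X Y hX hY
    have h1 := congrArg (fun a ↦ ⁅S.ξ, a⁆) (hsum hX hY)
    rw [lie_add, hα hX hY, hβ hX hY, lie_mul_const _ four, S.lie_ξ_ric] at h1
    have h2 := hsum (S.φ_lie_ξ hX) hY
    have h3 := hsum hX (S.φ_lie_ξ' hY)
    rw [← sub_eq_zero]
    refine eq_zero_of_two_mul (eq_zero_of_two_mul ?_)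
    linear_combination -h1 + h2 + h3 + 2 * hsum hX hY
  have h0 : S.g ⁅u, X⁆ Y = 0 := by
    have h1 := congrArg (fun a ↦ ⁅S.ξ, a⁆) (heq hX hY)
    rw [hα hX hY, lie_mul_const _ two, S.lie_ξ_ric] at h1
    refine eq_zero_of_two_mul ?_
    linear_combination -h1 + heq (S.φ_lie_ξ hX) hY + heq hX (S.φ_lie_ξ' hY)
  have h1 := hsum hX hY
  have h2 := heq hX hY
  refine ⟨h0, by linear_combination h1 - 2 * h2 + h0, ?_⟩
  rw [h.lieG_aux_mixed_ric hX hY]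
  linear_combination 2 * h2 - 2 * h0

theorem φ_φ_lie_aux (h : S.IsSoliton v l m 0) {X : L} (hX : S.φ X = X) :
    S.φ (S.φ ⁅aux S v, X⁆) = S.φ ⁅aux S v, X⁆ := by
  refine S.g_ext fun Z ↦ ?_
  have h1 := (h.lie_aux_mixed hX (S.φ_proj' Z)).1
  rw [map_sub, ← S.g_φ_left, ← S.g_φ_left, ← S.g_φ_left] at h1
  linear_combination h1

theorem φ_φ_lie_aux' (h : S.IsSoliton v l m 0) {X : L} (hX : S.φ X = -X) :
    S.φ (S.φ ⁅aux S v, X⁆) = -S.φ ⁅aux S v, X⁆ := by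
  refine S.g_ext fun Z ↦ ?_
  have h1 := (h.lie_aux_mixed (S.φ_proj Z) hX).2.1
  rw [map_add, LinearMap.add_apply, S.g_φ_left, S.g_φ_left, S.g_φ_left, S.g_symm Z,
    S.g_symm Z] at h1
  rw [map_neg, LinearMap.neg_apply]
  linear_combination h1

theorem lieG_eigen_eq_zero {X Y Z : L} (hX : S.φ X = -X) (hY : S.φ Y = Y) (hZ : S.φ Z = Z) :
    S.lieG X Y Z = 0 := by
  rw [lieG_eq, S.g_symm, S.g_eq_zero hZ (S.conn_φ_of_ne hY hX),
    S.g_eq_zero hY (S.conn_φ_of_ne hZ hX), add_zero]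

theorem lieG_lie_aux_eq_zero (h : S.IsSoliton v l m 0) {X Y Z : L} (hX : S.φ X = -X)
    (hY : S.φ Y = Y) (hZ : S.φ Z = Z) : S.lieG X ⁅aux S v, Y⁆ Z = 0 := by
  have hW := h.φ_φ_lie_aux hY
  set W := ⁅aux S v, Y⁆
  have h1 : W = S.φ W + S.η W • S.ξ := by
    rw [← hW, S.φ_φ]; module
  have h2 : S.φ (S.conn S.ξ X) = -S.conn S.ξ X := by
    rw [← S.conn_ξ_φ, hX, map_neg]
  rw [h1, lieG_add_left, lieG_smul_left, lieG_eigen_eq_zero hX hW hZ, lieG_eq, S.g_symm,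
    S.g_eq_zero hZ h2, S.ξ_g, S.η_eq_zero' (S.conn_φ_of_ne hZ hX)]
  ring

/-- The function `η(v)` is constant along the `-1`-eigendistribution of `φ`. -/
theorem lie_η_eq_zero (h : S.IsSoliton v l m 0) (hn : n ≠ 0) {X : L} (hX : S.φ X = -X) :
    ⁅X, S.η v⁆ = 0 := by
  have hη : S.η ⁅aux S v, X⁆ = 0 := by
    refine S.eq_zero_of_mul_g hn fun Y Z hY hZ ↦ ?_
    have h1 := S.lieG_lie (aux S v) X Y Z
    have four : ⁅X, (-4 : A)⁆ = 0 := by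
      have := lie_natCast_eq_zero (A := A) X 4
      rw [lie_neg, neg_eq_zero]; simpa using this
    have hlm : ⁅X, -4 * (l + m)⁆ = 0 := by
      rw [lie_mul_const _ four, lie_add, h.lie_l, h.lie_m]; ring
    have hk : ∀ {Y Z : L}, S.φ Y = Y → S.φ Z = Z →
        S.lieG (aux S v) ⁅X, Y⁆ Z = -4 * (l + m) * S.g (S.conn X Y) Z := fun {Y Z} hY hZ ↦ by
      rw [← S.conn_torsion, lieG_sub_left, h.lieG_aux_eigen (S.conn_φ_of_ne' hX hY) hZ,
        lieG_symm _ _ (S.conn Y X), (h.lie_aux_mixed hZ (S.conn_φ_of_ne hY hX)).2.2, sub_zero]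
    rw [lieG_eigen_eq_zero hX hY hZ, h.lieG_lie_aux_eq_zero hX hY hZ,
      lieG_symm _ X Y, h.lieG_lie_aux_eq_zero hX hZ hY, h.lieG_aux_eigen hY hZ, hk hY hZ,
      lieG_symm _ (aux S v) Y ⁅X, Z⁆, hk hZ hY, lie_mul_const _ hlm, lie_zero, S.conn_metric,
      S.g_symm (S.conn X Z)] at h1
    have hW := h.φ_φ_lie_aux' hX
    set W := ⁅aux S v, X⁆
    have h2 : W = S.η W • S.ξ - S.φ W := by
      have := S.φ_φ W
      rw [hW] at this
      linear_combination (norm := module) -this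
    have h3 : ∀ {Y Z : L}, S.φ Y = Y → S.φ Z = Z → S.g (S.conn Y W) Z = S.η W * S.g Y Z := by
      intro Y Z hY hZ
      conv_lhs => rw [h2]
      rw [map_sub, map_sub, LinearMap.sub_apply, S.g_symm (S.conn Y (S.φ W)),
        S.g_eq_zero hZ (S.conn_φ_of_ne hY hW), S.conn_smul, S.conn_ξ, hY]
      simp [S.ξ_g, S.η_eq_zero hZ]
    rw [lieG_eq, h3 hY hZ, S.g_symm Y (S.conn Z W), h3 hZ hY, S.g_symm Z] at h1
    exact eq_zero_of_two_mul (by linear_combination h1)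
  have h1 := S.lie_η_sub (aux S v) X
  rw [hη, S.η_eq_zero' hX, lie_zero, aux, map_add, map_add, S.η_φ, lie_add, lie_add,
    lie_zero] at h1
  exact eq_zero_of_two_mul (by linear_combination -h1)

theorem lie_ξ_eq_zero (h : S.IsSoliton v l m 0) (hn : n ≠ 0) : ⁅S.ξ, v⁆ = 0 := by
  refine S.g_nondeg _ fun Y ↦ eq_zero_of_two_mul ?_
  have h1 := h.lie_η_eq_zero hn (S.φ_proj' Y)
  have h2 := h.neg.lie_η_eq_zero hn (X := S.φ (S.φ Y) + S.φ Y) (by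
    rw [neg_φ, LinearMap.neg_apply, S.φ_proj])
  rw [neg_η, LinearMap.neg_apply, lie_neg, neg_eq_zero] at h2
  have h3 : ⁅S.φ (S.φ Y), S.η v⁆ + ⁅S.φ (S.φ Y), S.η v⁆ = 0 := by
    rw [sub_lie] at h1
    rw [add_lie] at h2
    linear_combination h1 + h2
  have h4 : S.g ⁅S.ξ, v⁆ Y = S.g ⁅S.ξ, v⁆ (S.φ (S.φ Y)) := by
    rw [S.φ_φ, map_sub, map_smul, S.g_ξ, h.η_lie]; simp
  rw [h4, h.g_lie]
  linear_combination -h3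

end IsSoliton

/-- A para-Ricci-like soliton on a para-Sasaki-like Riemannian `Π`-manifold, algebraically. -/
theorem soliton_main (hn : n ≠ 0) {v : L} {l m c : A} (h : S.IsSoliton v l m c) :
    c = 0 ∧ S.conn S.ξ v = S.φ v ∧ ⁅v, S.ξ⁆ = 0 := by
  obtain rfl := h.const_eq_zero hn
  have h1 := h.lie_ξ_eq_zero hn
  refine ⟨rfl, ?_, by rw [← lie_skew, h1, neg_zero]⟩
  rw [← sub_eq_zero, ← S.lie_ξ, h1]

end ParaSasakiLikeData

end AlgebraicSoliton

noncomputable section SmoothFields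

open TopologicalSpace Filter
open scoped Topology

variable {E : Type*} [NormedAddCommGroup E] [NormedSpace ℝ E] [FiniteDimensional ℝ E]
  {H : Type*} [TopologicalSpace H] (I : ModelWithCorners ℝ E H)
  {M : Type*} [TopologicalSpace M] [ChartedSpace H M] [IsManifold I ∞ M]
  (U : Opens M)

open Classical in
/-- Extension by zero of a dependent function on an open set. -/
def extendZero {V : M → Type*} [∀ x, Zero (V x)] (f : Π x : U, V x) (x : M) : V x :=
  if h : x ∈ U then f ⟨x, h⟩ else 0

variable {U} in
theorem extendZero_of_mem {V : M → Type*} [∀ x, Zero (V x)] (f : Π x : U, V x) {x : M}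
    (hx : x ∈ U) : extendZero U f x = f ⟨x, hx⟩ := by
  simp [extendZero, hx]

variable {U} in
theorem extendZero_eventuallyEq {V : M → Type*} [∀ x, Zero (V x)] (F : Π x : M, V x) {x : M}
    (hx : x ∈ U) : ∀ᶠ y in 𝓝 x, extendZero (V := V) U (fun y : U ↦ F y) y = F y := by
  filter_upwards [U.isOpen.mem_nhds hx] with y hy
  exact extendZero_of_mem (V := V) _ hy

theorem ContMDiffAt.congr_section {X Y : Π x : M, TangentSpace I x} {x : M}
    (hX : CMDiffAt ∞ (T% X) x) (h : ∀ᶠ y in 𝓝 x, Y y = X y) : CMDiffAt ∞ (T% Y) x :=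
  hX.congr_of_eventuallyEq (h.mono fun y hy ↦ by simp [hy])

/-- The algebra of smooth functions on an open set. -/
def smoothFunctions : Subalgebra ℝ (U → ℝ) where
  carrier := {f | ∀ x ∈ U, CMDiffAt ∞ (extendZero U (V := fun _ ↦ ℝ) f) x}
  mul_mem' {f g} hf hg x hx := by
    refine ((hf x hx).mul (hg x hx)).congr_of_eventuallyEq (.of_eq ?_)
    ext y
    by_cases hy : y ∈ U <;> simp [extendZero, hy]
  add_mem' {f g} hf hg x hx := by
    refine ((hf x hx).add (hg x hx)).congr_of_eventuallyEq (.of_eq ?_)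
    ext y
    by_cases hy : y ∈ U <;> simp [extendZero, hy]
  algebraMap_mem' c x hx :=
    (contMDiffAt_const (c := c)).congr_of_eventuallyEq
      (extendZero_eventuallyEq (V := fun _ ↦ ℝ) (fun _ ↦ c) hx)

/-- The module of smooth vector fields on an open set. -/
def smoothFields : Submodule (smoothFunctions I U) (Π x : U, TangentSpace I (x : M)) where
  carrier := {X | ∀ x ∈ U, CMDiffAt ∞ (T% (extendZero U X)) x}
  zero_mem' x hx := ((contMDiff_zeroSection ℝ (fun x : M ↦ TangentSpace I x)) x).congr_section I
    (extendZero_eventuallyEq (fun _ ↦ 0) hx)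
  add_mem' {X Y} hX hY x hx := by
    refine ((hX x hx).add_section (hY x hx)).congr_section I (.of_forall fun y ↦ ?_)
    by_cases hy : y ∈ U <;> simp [extendZero, hy]
  smul_mem' f X hX x hx := by
    refine ((f.2 x hx).smul_section (hX x hx)).congr_section I (.of_forall fun y ↦ ?_)
    by_cases hy : y ∈ U
    · simp [extendZero, hy]; rfl
    · simp [extendZero, hy]

/-- Smooth functions on an open set. -/
def SmoothFunction := ↥(smoothFunctions I U)

/-- Smooth vector fields on an open set. -/
def SmoothField := ↥(smoothFields I U)

instance : CommRing (SmoothFunction I U) := inferInstanceAs (CommRing (smoothFunctions I U))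

instance : AddCommGroup (SmoothField I U) := inferInstanceAs (AddCommGroup (smoothFields I U))

instance : Module (SmoothFunction I U) (SmoothField I U) :=
  inferInstanceAs (Module (smoothFunctions I U) (smoothFields I U))

namespace SmoothFunction

variable {I U}

/-- Extension by zero of a smooth function. -/
def zext (f : SmoothFunction I U) : M → ℝ := extendZero U (V := fun _ ↦ ℝ) f.1

theorem contMDiffAt (f : SmoothFunction I U) {x : M} (hx : x ∈ U) : CMDiffAt ∞ f.zext x :=
  f.2 x hx

theorem mdifferentiableAt (f : SmoothFunction I U) {x : M} (hx : x ∈ U) : MDiffAt f.zext x :=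
  (f.contMDiffAt hx).mdifferentiableAt (by simp)

/-- Restriction of a function to an open set where it is smooth. -/
def mk (F : M → ℝ) (hF : ∀ x ∈ U, CMDiffAt ∞ F x) : SmoothFunction I U :=
  ⟨fun x ↦ F x, fun x hx ↦ (hF x hx).congr_of_eventuallyEq
    (extendZero_eventuallyEq (V := fun _ ↦ ℝ) F hx)⟩

@[simp] theorem mk_apply (F : M → ℝ) (hF : ∀ x ∈ U, CMDiffAt ∞ F x) (x : U) :
    (mk (I := I) F hF).1 x = F x := rfl

theorem zext_mk (F : M → ℝ) (hF : ∀ x ∈ U, CMDiffAt ∞ F x) {x : M} (hx : x ∈ U) :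
    (mk (I := I) F hF).zext =ᶠ[𝓝 x] F :=
  extendZero_eventuallyEq (V := fun _ ↦ ℝ) F hx

@[simp] theorem zext_coe (f : SmoothFunction I U) (x : U) : f.zext x = f.1 x :=
  extendZero_of_mem (V := fun _ ↦ ℝ) f.1 x.2

@[simp] theorem coe_add_apply (f g : SmoothFunction I U) (x : U) :
    (f + g).1 x = f.1 x + g.1 x := rfl

@[simp] theorem coe_mul_apply (f g : SmoothFunction I U) (x : U) :
    (f * g).1 x = f.1 x * g.1 x := rfl

theorem zext_add (f g : SmoothFunction I U) : (f + g).zext = f.zext + g.zext := by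
  ext y
  by_cases hy : y ∈ U <;> simp [zext, extendZero, hy]

theorem zext_mul (f g : SmoothFunction I U) : (f * g).zext = f.zext * g.zext := by
  ext y
  by_cases hy : y ∈ U <;> simp [zext, extendZero, hy]

theorem eq_of_apply {f g : SmoothFunction I U} (h : ∀ x : U, f.1 x = g.1 x) : f = g :=
  Subtype.ext (funext h)

end SmoothFunction

namespace SmoothField

variable {I U}

/-- Extension by zero of a smooth vector field. -/
def zext (X : SmoothField I U) : Π x : M, TangentSpace I x := extendZero U X.1

theorem contMDiffAt (X : SmoothField I U) {x : M} (hx : x ∈ U) : CMDiffAt ∞ (T% X.zext) x :=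
  X.2 x hx

theorem mdifferentiableAt (X : SmoothField I U) {x : M} (hx : x ∈ U) : MDiffAt (T% X.zext) x :=
  (X.contMDiffAt hx).mdifferentiableAt (by simp)

/-- Restriction of a vector field to an open set where it is smooth. -/
def mk (F : Π x : M, TangentSpace I x) (hF : ∀ x ∈ U, CMDiffAt ∞ (T% F) x) : SmoothField I U :=
  ⟨fun x ↦ F x, fun x hx ↦ (hF x hx).congr_section I (extendZero_eventuallyEq F hx)⟩

@[simp] theorem mk_apply (F : Π x : M, TangentSpace I x) (hF : ∀ x ∈ U, CMDiffAt ∞ (T% F) x)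
    (x : U) : (mk F hF).1 x = F x := rfl

theorem zext_mk (F : Π x : M, TangentSpace I x) (hF : ∀ x ∈ U, CMDiffAt ∞ (T% F) x) {x : M}
    (hx : x ∈ U) : (mk F hF).zext =ᶠ[𝓝 x] F :=
  extendZero_eventuallyEq F hx

@[simp] theorem zext_coe (X : SmoothField I U) (x : U) : X.zext x = X.1 x :=
  extendZero_of_mem X.1 x.2

@[simp] theorem coe_add_apply (X Y : SmoothField I U) (x : U) :
    (X + Y).1 x = X.1 x + Y.1 x := rfl

theorem zext_add (X Y : SmoothField I U) : (X + Y).zext = X.zext + Y.zext := by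
  ext y
  by_cases hy : y ∈ U <;> simp [zext, extendZero, hy]

theorem zext_smul (f : SmoothFunction I U) (X : SmoothField I U) :
    (f • X).zext = f.zext • X.zext := by
  ext y
  by_cases hy : y ∈ U
  · simp [zext, SmoothFunction.zext, extendZero, hy]; rfl
  · simp [zext, SmoothFunction.zext, extendZero, hy]

@[simp] theorem coe_zero_apply (x : U) : (0 : SmoothField I U).1 x = 0 := rfl

@[simp] theorem coe_smul_apply (f : SmoothFunction I U) (X : SmoothField I U) (x : U) :
    (f • X).1 x = f.1 x • X.1 x := rfl

theorem eq_of_apply {X Y : SmoothField I U} (h : ∀ x : U, X.1 x = Y.1 x) : X = Y :=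
  Subtype.ext (funext h)

end SmoothField

variable {I}

theorem contMDiffAt_mlieBracket {X Y : Π x : M, TangentSpace I x} {x : M}
    (hX : CMDiffAt ∞ (T% X) x) (hY : CMDiffAt ∞ (T% Y) x) :
    CMDiffAt ∞ (T% (mlieBracket I X Y)) x := by
  have : IsManifold I (minSmoothness ℝ 2) M := by
    simpa using (inferInstanceAs (IsManifold I 2 M))
  have : IsManifold I ((⊤ : ℕ∞) + 1) M := inferInstanceAs (IsManifold I ∞ M)
  exact ContMDiffAt.mlieBracket_vectorField (m := ⊤) (n := ⊤) hX hY (by simp)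

theorem contMDiffAt_mvfderiv_apply {f : M → ℝ} {X : Π x : M, TangentSpace I x} {x : M}
    (hf : CMDiffAt ∞ f x) (hX : CMDiffAt ∞ (T% X) x) :
    CMDiffAt ∞ (fun y ↦ d% f y (X y)) x := by
  have h1 := hf.mfderiv_const (m := ∞) (by simp)
  have h2 := ContMDiffAt.clm_apply_of_inCoordinates (E₁ := fun x : M ↦ TangentSpace I x)
    (E₂ := fun x : ℝ ↦ TangentSpace 𝓘(ℝ) x) (b₂ := f) h1 hX hf
  rw [contMDiffAt_totalSpace] at h2
  refine h2.2.congr_of_eventuallyEq (.of_eq ?_)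
  ext y
  simp [mvfderiv]
  rfl

variable {U}

instance : Bracket (SmoothField I U) (SmoothField I U) where
  bracket X Y := .mk (mlieBracket I X.zext Y.zext) fun _ hx ↦
    contMDiffAt_mlieBracket (X.contMDiffAt hx) (Y.contMDiffAt hx)

instance : Bracket (SmoothField I U) (SmoothFunction I U) where
  bracket X f := .mk (fun x ↦ d% f.zext x (X.zext x)) fun _ hx ↦
    contMDiffAt_mvfderiv_apply (f.contMDiffAt hx) (X.contMDiffAt hx)

theorem lie_field_apply (X Y : SmoothField I U) (x : U) :
    ⁅X, Y⁆.1 x = mlieBracket I X.zext Y.zext x := rfl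

theorem lie_function_apply (X : SmoothField I U) (f : SmoothFunction I U) (x : U) :
    ⁅X, f⁆.1 x = d% f.zext x (X.zext x) := rfl

theorem lie_ext_eventuallyEq (X Y : SmoothField I U) {x : M} (hx : x ∈ U) :
    ⁅X, Y⁆.zext =ᶠ[𝓝 x] mlieBracket I X.zext Y.zext :=
  SmoothField.zext_mk _ _ hx

instance : LieRing (SmoothField I U) where
  add_lie X Y Z := SmoothField.eq_of_apply fun x ↦ by
    simp only [lie_field_apply, SmoothField.coe_add_apply, SmoothField.zext_add]
    exact mlieBracket_add_left (X.mdifferentiableAt x.2) (Y.mdifferentiableAt x.2)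
  lie_add X Y Z := SmoothField.eq_of_apply fun x ↦ by
    simp only [lie_field_apply, SmoothField.coe_add_apply, SmoothField.zext_add]
    exact mlieBracket_add_right (Y.mdifferentiableAt x.2) (Z.mdifferentiableAt x.2)
  lie_self X := SmoothField.eq_of_apply fun x ↦ by
    simp [lie_field_apply]
  leibniz_lie X Y Z := SmoothField.eq_of_apply fun x ↦ by
    have : IsManifold I (minSmoothness ℝ 3) M := by
      simpa using (inferInstanceAs (IsManifold I 3 M))
    simp only [lie_field_apply, SmoothField.coe_add_apply]
    have e1 : mlieBracket I X.zext ⁅Y, Z⁆.zext x =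
        mlieBracket I X.zext (mlieBracket I Y.zext Z.zext) x :=
      EventuallyEq.rfl.mlieBracket_vectorField_eq (lie_ext_eventuallyEq Y Z x.2)
    have e2 : mlieBracket I ⁅X, Y⁆.zext Z.zext x =
        mlieBracket I (mlieBracket I X.zext Y.zext) Z.zext x :=
      (lie_ext_eventuallyEq X Y x.2).mlieBracket_vectorField_eq EventuallyEq.rfl
    have e3 : mlieBracket I Y.zext ⁅X, Z⁆.zext x =
        mlieBracket I Y.zext (mlieBracket I X.zext Z.zext) x :=
      EventuallyEq.rfl.mlieBracket_vectorField_eq (lie_ext_eventuallyEq X Z x.2)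
    rw [e1, e2, e3]
    have h2 : ∀ X : SmoothField I U, CMDiffAt (minSmoothness ℝ 2) (T% X.zext) (x : M) := fun X ↦
      (X.contMDiffAt x.2).of_le (by
        rw [minSmoothness_of_isRCLikeNormedField]
        exact WithTop.coe_le_coe.2 (le_top (a := (2 : ℕ∞))))
    exact leibniz_identity_mlieBracket_apply (h2 X) (h2 Y) (h2 Z)

theorem lie_field_smul (X Y : SmoothField I U) (f : SmoothFunction I U) :
    ⁅X, f • Y⁆ = f • ⁅X, Y⁆ + ⁅X, f⁆ • Y := SmoothField.eq_of_apply fun x ↦ by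
  simp only [lie_field_apply, SmoothField.coe_add_apply, SmoothField.zext_smul,
    SmoothField.coe_smul_apply, lie_function_apply]
  rw [mlieBracket_smul_right (f.mdifferentiableAt x.2) (Y.mdifferentiableAt x.2)]
  simp [add_comm]

end SmoothFields

noncomputable section FramedOpens

open TopologicalSpace Filter
open scoped Topology

variable {E : Type*} [NormedAddCommGroup E] [NormedSpace ℝ E] [FiniteDimensional ℝ E]
  {H : Type*} [TopologicalSpace H] (I : ModelWithCorners ℝ E H)
  {M : Type*} [TopologicalSpace M] [ChartedSpace H M] [IsManifold I ∞ M]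
  (U : Opens M)

/-- An open set over which one of the preferred trivializations of the tangent bundle is defined. -/
class FramedOpen : Prop where
  exists_subset_baseSet :
    ∃ x₀ : M, (U : Set M) ⊆ (trivializationAt E (TangentSpace I : M → Type _) x₀).baseSet

variable [FramedOpen I U]

namespace FramedOpen

/-- A trivialization of the tangent bundle over a framed open set. -/
abbrev triv : Trivialization E (TotalSpace.proj : TotalSpace E (TangentSpace I : M → Type _) → M) :=
  trivializationAt E (TangentSpace I) (exists_subset_baseSet (I := I) (U := U)).choose

theorem mem_baseSet {x : M} (hx : x ∈ U) : x ∈ (triv I U).baseSet :=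
  (exists_subset_baseSet (I := I) (U := U)).choose_spec hx

/-- The basis of the tangent space at a point of a framed open set. -/
def basisAt (x : U) : Module.Basis (Fin (Module.finrank ℝ E)) ℝ (TangentSpace I (x : M)) :=
  (triv I U).basisAt (Module.finBasis ℝ E) (mem_baseSet I U x.2)

end FramedOpen

open FramedOpen

variable {I U}

/-- Evaluation of smooth functions at a point. -/
def SmoothFunction.eval (x : U) : SmoothFunction I U →+* ℝ where
  toFun f := f.1 x
  map_one' := rfl
  map_mul' _ _ := rfl
  map_zero' := rfl
  map_add' _ _ := rfl

@[simp] theorem SmoothFunction.eval_apply (x : U) (f : SmoothFunction I U) :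
    SmoothFunction.eval x f = f.1 x := rfl

/-- Evaluation of smooth vector fields at a point. -/
def SmoothField.eval (x : U) : SmoothField I U →+ TangentSpace I (x : M) where
  toFun X := X.1 x
  map_zero' := rfl
  map_add' _ _ := rfl

@[simp] theorem SmoothField.eval_apply (x : U) (X : SmoothField I U) :
    SmoothField.eval x X = X.1 x := rfl

instance : IsAddTorsionFree (SmoothFunction I U) where
  nsmul_right_injective k hk f g h := SmoothFunction.eq_of_apply fun x ↦ by
    have := congr(SmoothFunction.eval x $h)
    simp only [map_nsmul] at this
    exact nsmul_right_injective hk this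

namespace SmoothField

variable (I U) in
/-- The local frame on a framed open set. -/
def frame (i : Fin (Module.finrank ℝ E)) : SmoothField I U :=
  .mk ((triv I U).localFrame (Module.finBasis ℝ E) i) fun _ hx ↦
    contMDiffAt_localFrame_of_mem _ _ _ i (mem_baseSet I U hx)

theorem frame_apply (i : Fin (Module.finrank ℝ E)) (x : U) :
    (frame I U i).1 x = basisAt I U x i :=
  (triv I U).localFrame_apply_of_mem_baseSet _ (mem_baseSet I U x.2)

/-- The components of a smooth vector field in the local frame. -/
def coord (X : SmoothField I U) (i : Fin (Module.finrank ℝ E)) : SmoothFunction I U :=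
  .mk (fun x ↦ (triv I U).localFrameCoeff I (Module.finBasis ℝ E) i x (X.zext x)) fun _ hx ↦
    contMDiffAt_localFrameCoeff (Module.finBasis ℝ E) (mem_baseSet I U hx) (X.contMDiffAt hx) i

theorem coord_apply (X : SmoothField I U) (i : Fin (Module.finrank ℝ E)) (x : U) :
    (X.coord i).1 x = (basisAt I U x).repr (X.1 x) i := by
  rw [← zext_coe]
  exact (triv I U).localFrameCoeff_apply_of_mem_baseSet _ (mem_baseSet I U x.2) X.zext i

theorem coe_sum_apply {ι : Type*} (s : Finset ι) (X : ι → SmoothField I U) (x : U) :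
    (∑ i ∈ s, X i).1 x = ∑ i ∈ s, (X i).1 x := map_sum (eval x) X s

theorem coe_sum_smul_frame_apply (c : Fin (Module.finrank ℝ E) → SmoothFunction I U) (x : U) :
    (∑ i, c i • frame I U i).1 x = ∑ i, (c i).1 x • basisAt I U x i := by
  rw [coe_sum_apply]
  simp [frame_apply]

variable (I U) in
/-- The local frame is a basis of the module of smooth vector fields. -/
def basis : Module.Basis (Fin (Module.finrank ℝ E)) (SmoothFunction I U) (SmoothField I U) :=
  .ofEquivFun
    { toFun := coord
      map_add' X Y := funext fun i ↦ SmoothFunction.eq_of_apply fun x ↦ by simp [coord_apply]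
      map_smul' a X := funext fun i ↦ SmoothFunction.eq_of_apply fun x ↦ by simp [coord_apply]
      invFun c := ∑ i, c i • frame I U i
      left_inv X := eq_of_apply fun x ↦ by
        rw [coe_sum_smul_frame_apply]
        simp [coord_apply, (basisAt I U x).sum_repr (X.1 x)]
      right_inv c := funext fun i ↦ SmoothFunction.eq_of_apply fun x ↦ by
        rw [coord_apply, coe_sum_smul_frame_apply, Module.Basis.repr_sum_self] }

theorem basis_repr (X : SmoothField I U) (i : Fin (Module.finrank ℝ E)) :
    (basis I U).repr X i = X.coord i := by
  simp [basis]

theorem basis_apply (i : Fin (Module.finrank ℝ E)) : basis I U i = frame I U i := by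
  rw [basis, Module.Basis.coe_ofEquivFun]
  change ∑ j, (Pi.single i (1 : SmoothFunction I U) : _ → SmoothFunction I U) j • frame I U j = _
  simp [Pi.single_apply]

instance : Module.Free (SmoothFunction I U) (SmoothField I U) := .of_basis (basis I U)

instance : Module.Finite (SmoothFunction I U) (SmoothField I U) := .of_basis (basis I U)

theorem trace_apply (T : SmoothField I U →ₗ[SmoothFunction I U] SmoothField I U) (x : U)
    (L : TangentSpace I (x : M) →ₗ[ℝ] TangentSpace I (x : M))
    (h : ∀ X : SmoothField I U, L (X.1 x) = (T X).1 x) :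
    (LinearMap.trace (SmoothFunction I U) (SmoothField I U) T).1 x = LinearMap.trace ℝ _ L := by
  rw [LinearMap.trace_eq_matrix_trace _ (basis I U), LinearMap.trace_eq_matrix_trace _
    (basisAt I U x), ← SmoothFunction.eval_apply, Matrix.trace, map_sum]
  refine Finset.sum_congr rfl fun i _ ↦ ?_
  simp [LinearMap.toMatrix_apply, basis_repr, coord_apply, basis_apply, ← h, frame_apply]

end SmoothField

variable [Nontrivial E]

instance : Nonempty (Fin (Module.finrank ℝ E)) :=
  ⟨⟨0, Module.finrank_pos⟩⟩

theorem SmoothFunction.eq_of_smul_frame {f g : SmoothFunction I U}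
    (h : ∀ Z : SmoothField I U, f • Z = g • Z) : f = g := eq_of_apply fun x ↦ by
  let i : Fin (Module.finrank ℝ E) := Classical.arbitrary _
  have := congr((SmoothField.eval x) $(h (SmoothField.frame I U i)))
  simp only [SmoothField.eval_apply, SmoothField.coe_smul_apply, SmoothField.frame_apply] at this
  exact smul_left_injective ℝ ((basisAt I U x).ne_zero i) this

instance : LieRingModule (SmoothField I U) (SmoothFunction I U) where
  add_lie X Y f := SmoothFunction.eq_of_apply fun x ↦ by
    simp [lie_function_apply]
  lie_add X f g := SmoothFunction.eq_of_apply fun x ↦ by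
    simp [lie_function_apply, SmoothFunction.zext_add,
      mvfderiv_add (f.mdifferentiableAt x.2) (g.mdifferentiableAt x.2)]
  leibniz_lie X Y f := SmoothFunction.eq_of_smul_frame fun Z ↦ by
    have h := leibniz_lie X Y (f • Z)
    have hZ := leibniz_lie X Y Z
    simp only [lie_field_smul, lie_add] at h
    rw [hZ] at h
    rw [add_smul]
    simp only [smul_add] at h
    rw [← sub_eq_zero] at h ⊢
    rw [← h]
    abel

instance : LieRinehartRing (SmoothFunction I U) (SmoothField I U) where
  lie_smul_eq_mul' a b X := SmoothFunction.eq_of_apply fun x ↦ by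
    simp [lie_function_apply]
  leibniz_mul_right' X a b := SmoothFunction.eq_of_apply fun x ↦ by
    simp [lie_function_apply, SmoothFunction.zext_mul,
      mvfderiv_mul (a.mdifferentiableAt x.2) (b.mdifferentiableAt x.2)]
    ring
  leibniz_smul_right' X Y a := lie_field_smul X Y a

end FramedOpens

noncomputable section LeviCivitaOnFramedOpens

open TopologicalSpace Filter
open scoped Topology

variable {E : Type*} [NormedAddCommGroup E] [NormedSpace ℝ E] [FiniteDimensional ℝ E]
  {H : Type*} [TopologicalSpace H] {I : ModelWithCorners ℝ E H}
  {M : Type*} [TopologicalSpace M] [ChartedSpace H M] [IsManifold I ∞ M]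
  [RiemannianBundle (fun x : M ↦ TangentSpace I x)]
  [IsContMDiffRiemannianBundle I ∞ E (fun x : M ↦ TangentSpace I x)]
  {U : Opens M}

theorem SmoothFunction.isUnit_of_forall_ne_zero {f : SmoothFunction I U} (h : ∀ x, f.1 x ≠ 0) :
    IsUnit f := by
  refine .of_mul_eq_one (.mk (fun x ↦ (f.zext x)⁻¹) fun x hx ↦ ?_) ?_
  · refine (f.contMDiffAt hx).inv₀ ?_
    lift x to U using hx
    simpa using h x
  · refine eq_of_apply fun x ↦ ?_
    simp only [coe_mul_apply, mk_apply, zext_coe, mul_inv_cancel₀ (h x)]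
    rfl

/-- Constant functions. -/
def SmoothFunction.const (c : ℝ) : SmoothFunction I U :=
  .mk (fun _ ↦ c) fun _ _ ↦ contMDiffAt_const

@[simp] theorem SmoothFunction.const_apply (c : ℝ) (x : U) :
    (const c : SmoothFunction I U).1 x = c := rfl

theorem lie_const (X : SmoothField I U) (c : ℝ) : ⁅X, (.const c : SmoothFunction I U)⁆ = 0 :=
  SmoothFunction.eq_of_apply fun x ↦ by
    rw [lie_function_apply]
    simp only [mvfderiv, (SmoothFunction.zext_mk (fun _ ↦ c) (fun _ _ ↦ contMDiffAt_const)
      x.2).mfderiv_eq, SmoothFunction.const]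
    simp
    rfl

@[simp] theorem SmoothFunction.coe_sub_apply (f g : SmoothFunction I U) (x : U) :
    (f - g).1 x = f.1 x - g.1 x := rfl

namespace SmoothField

@[simp] theorem coe_sub_apply (X Y : SmoothField I U) (x : U) :
    (X - Y).1 x = X.1 x - Y.1 x := rfl

variable (I U) in
/-- The metric, on smooth vector fields. -/
def metric : SmoothField I U →ₗ[SmoothFunction I U] SmoothField I U →ₗ[SmoothFunction I U]
    SmoothFunction I U :=
  LinearMap.mk₂ _ (fun X Y ↦ .mk (fun x ↦ inner ℝ (X.zext x) (Y.zext x)) fun x hx ↦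
      ContMDiffAt.inner_bundle (E := fun x : M ↦ TangentSpace I x)
        (X.contMDiffAt hx) (Y.contMDiffAt hx))
    (fun X X' Y ↦ SmoothFunction.eq_of_apply fun x ↦ by simp [inner_add_left])
    (fun a X Y ↦ SmoothFunction.eq_of_apply fun x ↦ by simp [inner_smul_left])
    (fun X Y Y' ↦ SmoothFunction.eq_of_apply fun x ↦ by simp [inner_add_right])
    (fun a X Y ↦ SmoothFunction.eq_of_apply fun x ↦ by simp [inner_smul_right])

@[simp] theorem metric_apply (X Y : SmoothField I U) (x : U) :
    (metric I U X Y).1 x = inner ℝ (X.1 x) (Y.1 x) := by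
  simp [metric]

theorem zext_metric (X Y : SmoothField I U) :
    (metric I U X Y).zext = fun x ↦ inner ℝ (X.zext x) (Y.zext x) := by
  ext x
  by_cases hx : x ∈ U
  · lift x to U using hx
    simp
  · simp [SmoothFunction.zext, zext, extendZero, hx]

theorem metric_comm (X Y : SmoothField I U) : metric I U X Y = metric I U Y X :=
  SmoothFunction.eq_of_apply fun x ↦ by simp [real_inner_comm]

/-- Koszul's formula, for smooth vector fields. -/
def koszulFunction (Y X Z : SmoothField I U) : SmoothFunction I U :=
  .const (1 / 2) * (⁅X, metric I U Y Z⁆ + ⁅Y, metric I U Z X⁆ - ⁅Z, metric I U X Y⁆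
    + metric I U ⁅X, Y⁆ Z - metric I U ⁅Y, Z⁆ X + metric I U ⁅Z, X⁆ Y)

theorem koszulFunction_apply (Y X Z : SmoothField I U) (x : U) :
    (koszulFunction Y X Z).1 x = koszul I Y.zext X.zext Z.zext x := by
  simp [koszulFunction, koszul, lie_function_apply, lie_field_apply, zext_metric]

variable [FramedOpen I U]

open FramedOpen Matrix

variable (I U) in
/-- The Gram matrix of the local frame. -/
def gram : Matrix (Fin (Module.finrank ℝ E)) (Fin (Module.finrank ℝ E)) (SmoothFunction I U) :=
  .of fun i j ↦ metric I U (frame I U i) (frame I U j)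

theorem isUnit_det_gram : IsUnit (gram I U).det := by
  refine SmoothFunction.isUnit_of_forall_ne_zero fun x ↦ ?_
  have : (gram I U).det.1 x = (Matrix.gram ℝ (basisAt I U x)).det := by
    rw [← SmoothFunction.eval_apply, RingHom.map_det]
    congr 1
    ext i j
    simp [gram, frame_apply, Matrix.gram_apply]
  rw [this]
  exact det_gram_ne_zero_iff_linearIndependent.2 (basisAt I U x).linearIndependent

theorem exists_metric_frame_eq (c : Fin (Module.finrank ℝ E) → SmoothFunction I U) :
    ∃ W : SmoothField I U, ∀ j, metric I U W (frame I U j) = c j := by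
  refine ⟨∑ i, (c ᵥ* (gram I U)⁻¹) i • frame I U i, fun j ↦ ?_⟩
  have h : (c ᵥ* (gram I U)⁻¹) ᵥ* gram I U = c := by
    rw [vecMul_vecMul, nonsing_inv_mul _ isUnit_det_gram, vecMul_one]
  conv_rhs => rw [← h]
  simp [vecMul, dotProduct, gram]

theorem exists_cov (X Y : SmoothField I U) :
    ∃ W : SmoothField I U, ∀ x : U, W.1 x = leviCivita I M Y.zext x (X.1 x) := by
  obtain ⟨W, hW⟩ := exists_metric_frame_eq fun j ↦ koszulFunction Y X (frame I U j)
  refine ⟨W, fun x ↦ InnerProductSpace.ext_inner_right_basis (basisAt I U x) fun j ↦ ?_⟩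
  have h := congr((SmoothFunction.eval x) $(hW j))
  simp only [SmoothFunction.eval_apply, metric_apply, koszulFunction_apply] at h
  rw [← inner_leviCivita (X.mdifferentiableAt x.2) (Y.mdifferentiableAt x.2)
    ((frame I U j).mdifferentiableAt x.2)] at h
  simpa [frame_apply] using h

/-- The covariant derivative `∇_X Y` of smooth vector fields. -/
def cov (X Y : SmoothField I U) : SmoothField I U := (exists_cov X Y).choose

theorem cov_apply (X Y : SmoothField I U) (x : U) :
    (cov X Y).1 x = leviCivita I M Y.zext x (X.1 x) := (exists_cov X Y).choose_spec x

theorem cov_eventuallyEq (X Y : SmoothField I U) {x : M} (hx : x ∈ U) :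
    ∀ᶠ p in 𝓝 x, (cov X Y).zext p = leviCivita I M Y.zext p (X.zext p) := by
  filter_upwards [U.isOpen.mem_nhds hx] with p hp
  lift p to U using hp
  simp [cov_apply]

end SmoothField

theorem leviCivita_congr {Y Y' : Π x : M, TangentSpace I x} {x : M}
    (h : ∀ᶠ p in 𝓝 x, Y' p = Y p) : leviCivita I M Y' x = leviCivita I M Y x := by
  have hiff : MDiffAt (T% Y') x ↔ MDiffAt (T% Y) x :=
    Filter.EventuallyEq.mdifferentiableAt_iff (h.mono fun y hy ↦ by simp [hy])
  by_cases hY : MDiffAt (T% Y) x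
  · exact ((leviCivita I M).isCovariantDerivativeOn (s := Set.univ)).congr_of_eventuallyEq
      (hiff.2 hY) hY univ_mem h
  · have h0 {W : Π x : M, TangentSpace I x} (hW : ¬MDiffAt (T% W) x) :
        leviCivita I M W x = 0 := by
      change leviCivitaFun W x = 0
      simp [leviCivitaFun, hW]
    rw [h0 hY, h0 (mt hiff.1 hY)]

theorem curvature_congr_eventuallyEq {X X' Y Y' Z Z' : Π x : M, TangentSpace I x} {x : M}
    (hX : ∀ᶠ y in 𝓝 x, X' y = X y) (hY : ∀ᶠ y in 𝓝 x, Y' y = Y y) (hZ : ∀ᶠ y in 𝓝 x, Z' y = Z y) :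
    curvature I X' Y' Z' x = curvature I X Y Z x := by
  have h {W W' : Π x : M, TangentSpace I x} (hW : ∀ᶠ y in 𝓝 x, W' y = W y) :
      leviCivita I M (fun p ↦ leviCivita I M Z' p (W' p)) x =
        leviCivita I M (fun p ↦ leviCivita I M Z p (W p)) x := by
    refine leviCivita_congr ?_
    filter_upwards [eventually_eventually_nhds.2 hZ, hW] with p hp hp'
    rw [leviCivita_congr hp, hp']
  rw [curvature, curvature, h hX, h hY, leviCivita_congr hZ, hX.self_of_nhds, hY.self_of_nhds,
    EventuallyEq.mlieBracket_vectorField_eq hX hY]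

namespace SmoothField

variable [FramedOpen I U]

theorem cov_add_left (X X' Y : SmoothField I U) : cov (X + X') Y = cov X Y + cov X' Y :=
  eq_of_apply fun x ↦ by simp [cov_apply]

theorem cov_smul_left (a : SmoothFunction I U) (X Y : SmoothField I U) :
    cov (a • X) Y = a • cov X Y :=
  eq_of_apply fun x ↦ by simp [cov_apply]

theorem cov_add_right (X Y Y' : SmoothField I U) : cov X (Y + Y') = cov X Y + cov X Y' :=
  eq_of_apply fun x ↦ by
    have := (leviCivita I M).isCovariantDerivativeOn.add (s := Set.univ)
      (Y.mdifferentiableAt x.2) (Y'.mdifferentiableAt x.2)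
    simp [cov_apply, zext_add, this]

theorem cov_smul_right (X : SmoothField I U) (a : SmoothFunction I U) (Y : SmoothField I U) :
    cov X (a • Y) = a • cov X Y + ⁅X, a⁆ • Y :=
  eq_of_apply fun x ↦ by
    have := (leviCivita I M).isCovariantDerivativeOn.leibniz (s := Set.univ)
      (Y.mdifferentiableAt x.2) (a.mdifferentiableAt x.2)
    simp [cov_apply, zext_smul, this, lie_function_apply]

theorem cov_sub_cov (X Y : SmoothField I U) : cov X Y - cov Y X = ⁅X, Y⁆ :=
  eq_of_apply fun x ↦ by
    have := (CovariantDerivative.torsion_eq_zero_iff (leviCivita I M)).1 leviCivita_torsion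
      (X.mdifferentiableAt x.2) (Y.mdifferentiableAt x.2)
    simpa [cov_apply, lie_field_apply] using this

theorem metric_cov (X Y Z : SmoothField I U) : metric I U (cov X Y) Z = koszulFunction Y X Z :=
  SmoothFunction.eq_of_apply fun x ↦ by
    rw [koszulFunction_apply, metric_apply, cov_apply, ← zext_coe X, ← zext_coe Z]
    exact inner_leviCivita (X.mdifferentiableAt x.2) (Y.mdifferentiableAt x.2)
      (Z.mdifferentiableAt x.2)

theorem lie_metric (X Y Z : SmoothField I U) :
    ⁅X, metric I U Y Z⁆ = metric I U (cov X Y) Z + metric I U Y (cov X Z) := by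
  have h2 : (SmoothFunction.const (1 / 2) : SmoothFunction I U) + .const (1 / 2) = 1 :=
    SmoothFunction.eq_of_apply fun x ↦ by
      simp only [SmoothFunction.coe_add_apply, SmoothFunction.const_apply, add_halves]
      rfl
  rw [metric_comm Y (cov X Z), metric_cov, metric_cov, koszulFunction, koszulFunction,
    metric_comm Z Y, metric_comm X Z, metric_comm Y X, ← lie_skew X Y, ← lie_skew X Z,
    ← lie_skew Y Z]
  simp only [map_neg, LinearMap.neg_apply]
  linear_combination (-⁅X, metric I U Y Z⁆) * h2

theorem curvature_apply (X Y Z : SmoothField I U) (x : U) :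
    (cov X (cov Y Z) - cov Y (cov X Z) - cov ⁅X, Y⁆ Z).1 x =
      curvature I X.zext Y.zext Z.zext x := by
  have h (X Y : SmoothField I U) : leviCivita I M (fun p ↦ leviCivita I M Y.zext p (X.zext p)) x =
      leviCivita I M (cov X Y).zext x :=
    leviCivita_congr ((cov_eventuallyEq X Y x.2).mono fun _ h ↦ h.symm)
  simp [curvature, cov_apply, h, lie_field_apply]

end SmoothField

end LeviCivitaOnFramedOpens

noncomputable section PiDataOnFramedOpens

open TopologicalSpace Filter
open scoped Topology

section Curvature

variable {A L : Type*} [CommRing A] [LieRing L] [Module A L] [LieRingModule L A]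
  [LieRinehartRing A L] {n : ℕ} (S : ParaSasakiLikeData A L n)

namespace ParaSasakiLikeData

theorem curv_swap (X Y Z : L) : S.curv X Y Z = -S.curv Y X Z := by
  simp only [curv]
  rw [← lie_skew X Y, map_neg, AddMonoidHom.neg_apply]
  abel

/-- The curvature, as a linear map in its second argument. -/
def curvMapMid (X Z : L) : L →ₗ[A] L := -S.curvMap X Z

theorem curvMapMid_apply (X Y Z : L) : S.curvMapMid X Z Y = S.curv X Y Z :=
  (S.curv_swap X Y Z).symm

/-- The curvature, as a linear map in its last argument. -/
def curvMapRight (X Y : L) : L →ₗ[A] L where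
  toFun Z := S.curv X Y Z
  map_add' Z Z' := by
    simp only [curv, map_add]; abel
  map_smul' a Z := by
    simp only [curv, map_add, S.conn_smul, lie_lie, sub_smul, RingHom.id_apply]
    module

end ParaSasakiLikeData

end Curvature

variable {E : Type*} [NormedAddCommGroup E] [NormedSpace ℝ E] [FiniteDimensional ℝ E]
  {H : Type*} [TopologicalSpace H] {I : ModelWithCorners ℝ E H}
  {M : Type*} [TopologicalSpace M] [ChartedSpace H M] [IsManifold I ∞ M]

theorem SmoothField.map_apply_congr {U : Opens M} [FramedOpen I U]
    (T : SmoothField I U →ₗ[SmoothFunction I U] SmoothField I U) {X X' : SmoothField I U} {x : U}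
    (h : X.1 x = X'.1 x) : (T X).1 x = (T X').1 x := by
  rw [← (basis I U).sum_repr X, ← (basis I U).sum_repr X']
  simp [coe_sum_apply, basis_repr, coord_apply, h]

theorem SmoothField.exists_apply_eq {U : Opens M} [FramedOpen I U] (x : U)
    (u : TangentSpace I (x : M)) : ∃ X : SmoothField I U, X.1 x = u :=
  ⟨∑ i, SmoothFunction.const (I := I) (U := U) ((FramedOpen.basisAt I U x).repr u i) •
      frame I U i, by
    rw [coe_sum_smul_frame_apply]
    exact (FramedOpen.basisAt I U x).sum_repr u⟩

theorem eventually_contMDiffAt_extend (x : M) (u : TangentSpace I x) :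
    ∀ᶠ y in 𝓝 x, CMDiffAt ∞ (T% (extend E u : Π x : M, TangentSpace I x)) y := by
  obtain ⟨s, hs, h⟩ := exists_contMDiffOn_extend (k := ∞) I E u
  filter_upwards [eventually_mem_nhds_iff.2 hs] with y hy
  exact h.contMDiffAt hy

theorem SmoothField.eventually_contMDiffAt {U : Opens M} (X : SmoothField I U) (x : U) :
    ∀ᶠ y in 𝓝 (x : M), CMDiffAt ∞ (T% X.zext) y := by
  filter_upwards [U.isOpen.mem_nhds x.2] with y hy
  exact X.contMDiffAt hy

variable [RiemannianBundle (fun x : M ↦ TangentSpace I x)]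
  [IsContMDiffRiemannianBundle I ∞ E (fun x : M ↦ TangentSpace I x)]

open FramedOpen SmoothField

namespace RiemannianPiStructure

variable (S : RiemannianPiStructure I M) {U : Opens M} [FramedOpen I U]

variable (U) in
/-- The tensor `φ`, on smooth vector fields. -/
def φField : SmoothField I U →ₗ[SmoothFunction I U] SmoothField I U where
  toFun X := .mk (fun x ↦ S.φ x (X.zext x)) fun x hx ↦
    (S.contMDiff_φ x).clm_bundle_apply (E₁ := fun x : M ↦ TangentSpace I x)
      (E₂ := fun x : M ↦ TangentSpace I x) (X.contMDiffAt hx)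
  map_add' X Y := SmoothField.eq_of_apply fun x ↦ by simp
  map_smul' a X := SmoothField.eq_of_apply fun x ↦ by simp

@[simp] theorem φField_apply (X : SmoothField I U) (x : U) :
    (S.φField U X).1 x = S.φ x (X.1 x) := by
  simp [φField]

theorem contMDiffAt_η_apply {X : Π x : M, TangentSpace I x} {x : M} (hX : CMDiffAt ∞ (T% X) x) :
    CMDiffAt ∞ (fun x ↦ S.η x (X x)) x :=
  (contMDiffAt_section (E := Bundle.Trivial M ℝ) x).1 <|
    (S.contMDiff_η x).clm_bundle_apply (E₁ := fun x : M ↦ TangentSpace I x)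
      (E₂ := Bundle.Trivial M ℝ) hX

variable (U) in
/-- The `1`-form `η`, on smooth vector fields. -/
def ηField : SmoothField I U →ₗ[SmoothFunction I U] SmoothFunction I U where
  toFun X := .mk (fun x ↦ S.η x (X.zext x)) fun _ hx ↦
    S.contMDiffAt_η_apply (X.contMDiffAt hx)
  map_add' X Y := SmoothFunction.eq_of_apply fun x ↦ by simp
  map_smul' a X := SmoothFunction.eq_of_apply fun x ↦ by simp

@[simp] theorem ηField_apply (X : SmoothField I U) (x : U) :
    (S.ηField U X).1 x = S.η x (X.1 x) := by
  simp [ηField]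

variable (U) in
/-- The vector field `ξ`, restricted to an open set. -/
def ξField : SmoothField I U := .mk S.ξ fun x _ ↦ S.contMDiff_ξ x

@[simp] theorem ξField_apply (x : U) : (S.ξField U).1 x = S.ξ x := rfl

theorem zext_φField (X : SmoothField I U) :
    (S.φField U X).zext = fun x ↦ S.φ x (X.zext x) := by
  ext x
  by_cases hx : x ∈ U
  · lift x to U using hx
    simp
  · simp [SmoothField.zext, extendZero, hx]

variable [Nontrivial E] {S} (hS : S.IsParaSasakiLike) {n : ℕ} (hE : Module.finrank ℝ E = 2 * n + 1)

variable (U) in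
/-- The algebraic data of a para-Sasaki-like manifold on the vector fields of a framed open set. -/
def toData : ParaSasakiLikeData (SmoothFunction I U) (SmoothField I U) n where
  g := metric I U
  conn :=
    { toFun X :=
        { toFun := cov X
          map_zero' := by simpa using cov_smul_right X 0 0
          map_add' := cov_add_right X }
      map_add' X X' := by ext Y; exact cov_add_left X X' Y
      map_smul' a X := by ext Y; exact cov_smul_left a X Y }
  φ := S.φField U
  ξ := S.ξField U
  η := S.ηField U
  g_symm := metric_comm
  g_nondeg X h := SmoothField.eq_of_apply fun x ↦ by
    have : SmoothFunction.eval x (metric I U X X) = 0 := by rw [h X, map_zero]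
    simpa using this
  conn_smul := cov_smul_right
  conn_torsion := cov_sub_cov
  conn_metric := lie_metric
  φ_ξ := SmoothField.eq_of_apply fun x ↦ by simp [S.φ_ξ]
  φ_φ X := SmoothField.eq_of_apply fun x ↦ by simp [S.φ_φ]
  η_φ X := SmoothFunction.eq_of_apply fun x ↦ by simp [S.η_φ]; rfl
  η_ξ := SmoothFunction.eq_of_apply fun x ↦ by simp [S.η_ξ]; rfl
  g_φ_φ X Y := SmoothFunction.eq_of_apply fun x ↦ by simp [S.inner_φ_φ]
  trace_φ := SmoothFunction.eq_of_apply fun x ↦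
    (trace_apply _ x (S.φ x).toLinearMap fun X ↦ by simp).trans (S.trace_φ x)
  trace_id := SmoothFunction.eq_of_apply fun x ↦ by
    rw [trace_apply _ x LinearMap.id fun X ↦ rfl, LinearMap.trace_id]
    change (Module.finrank ℝ E : ℝ) = SmoothFunction.eval x (2 * n + 1)
    simp only [hE, map_add, map_mul, map_one, map_ofNat, map_natCast]
    push_cast
    rfl
  conn_φ X Y := SmoothField.eq_of_apply fun x ↦ by
    have h := hS x (X.1 x) Y.zext (Y.mdifferentiableAt x.2)
    rw [covDerivφ, sub_eq_iff_eq_add, zext_coe] at h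
    have h2 : (2 * S.ηField U X * S.ηField U Y).1 x = 2 * S.η x (X.1 x) * S.η x (Y.1 x) := by
      rw [← S.ηField_apply, ← S.ηField_apply, ← SmoothFunction.eval_apply]
      simp only [map_mul, map_ofNat, SmoothFunction.eval_apply]
    change (cov X (S.φField U Y)).1 x = (S.φField U (cov X Y) - metric I U X Y • S.ξField U
      - S.ηField U Y • X + (2 * S.ηField U X * S.ηField U Y) • S.ξField U).1 x
    simp only [cov_apply, zext_φField, coe_add_apply, coe_sub_apply, coe_smul_apply, φField_apply,
      ξField_apply, ηField_apply, metric_apply, h, h2]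
    module

theorem toData_curv_apply (X Y Z : SmoothField I U) (x : U) :
    ((toData U hS hE).curv X Y Z).1 x = curvature I X.zext Y.zext Z.zext x :=
  SmoothField.curvature_apply X Y Z x

theorem curvature_congr (hS : S.IsParaSasakiLike) (hE : Module.finrank ℝ E = 2 * n + 1)
    {X X' Y Y' Z Z' : Π x : M, TangentSpace I x} {x : M}
    (hX : ∀ᶠ y in 𝓝 x, CMDiffAt ∞ (T% X) y) (hX' : ∀ᶠ y in 𝓝 x, CMDiffAt ∞ (T% X') y)
    (hY : ∀ᶠ y in 𝓝 x, CMDiffAt ∞ (T% Y) y) (hY' : ∀ᶠ y in 𝓝 x, CMDiffAt ∞ (T% Y') y)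
    (hZ : ∀ᶠ y in 𝓝 x, CMDiffAt ∞ (T% Z) y) (hZ' : ∀ᶠ y in 𝓝 x, CMDiffAt ∞ (T% Z') y)
    (eX : X x = X' x) (eY : Y x = Y' x) (eZ : Z x = Z' x) :
    curvature I X Y Z x = curvature I X' Y' Z' x := by
  obtain ⟨V, hV, hVo, hxV⟩ := eventually_nhds_iff.1 (hX.and <| hX'.and <| hY.and <| hY'.and <|
    hZ.and <| hZ'.and <| (trivializationAt E (TangentSpace I) x).open_baseSet.mem_nhds
      (FiberBundle.mem_baseSet_trivializationAt' x))
  lift V to Opens M using hVo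
  have : FramedOpen I V := ⟨⟨x, fun y hy ↦ (hV y hy).2.2.2.2.2.2⟩⟩
  lift x to V using hxV
  let X₀ : SmoothField I V := .mk X fun y hy ↦ (hV y hy).1
  let X₁ : SmoothField I V := .mk X' fun y hy ↦ (hV y hy).2.1
  let Y₀ : SmoothField I V := .mk Y fun y hy ↦ (hV y hy).2.2.1
  let Y₁ : SmoothField I V := .mk Y' fun y hy ↦ (hV y hy).2.2.2.1
  let Z₀ : SmoothField I V := .mk Z fun y hy ↦ (hV y hy).2.2.2.2.1
  let Z₁ : SmoothField I V := .mk Z' fun y hy ↦ (hV y hy).2.2.2.2.2.1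
  let D := toData V hS hE
  calc curvature I X Y Z x = (D.curv X₀ Y₀ Z₀).1 x := by
        rw [toData_curv_apply]
        exact (curvature_congr_eventuallyEq (zext_mk _ _ x.2) (zext_mk _ _ x.2)
          (zext_mk _ _ x.2)).symm
    _ = (D.curv X₁ Y₀ Z₀).1 x := map_apply_congr (D.curvMap Y₀ Z₀) eX
    _ = (D.curv X₁ Y₁ Z₀).1 x := by
        rw [← D.curvMapMid_apply, ← D.curvMapMid_apply]
        exact map_apply_congr _ eY
    _ = (D.curv X₁ Y₁ Z₁).1 x := map_apply_congr (D.curvMapRight X₁ Y₁) eZ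
    _ = curvature I X' Y' Z' x := by
        rw [toData_curv_apply]
        exact curvature_congr_eventuallyEq (zext_mk _ _ x.2) (zext_mk _ _ x.2) (zext_mk _ _ x.2)

theorem toData_ric_apply (Y Z : SmoothField I U) (x : U) :
    ((toData U hS hE).ric Y Z).1 x = ricci I (x : M) (Y.1 x) (Z.1 x) := by
  let D := toData U hS hE
  let b := basisAt I U x
  let L : TangentSpace I (x : M) →ₗ[ℝ] TangentSpace I (x : M) :=
    b.constr ℝ fun i ↦ (D.curv (frame I U i) Y Z).1 x
  have hL (X : SmoothField I U) : L (X.1 x) = (D.curvMap Y Z X).1 x := by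
    rw [← (basis I U).sum_repr X, map_sum, coe_sum_apply, coe_sum_apply, map_sum]
    refine Finset.sum_congr rfl fun i _ ↦ ?_
    rw [map_smul, coe_smul_apply, coe_smul_apply, map_smul, basis_apply, frame_apply,
      b.constr_basis]
    rfl
  rw [ParaSasakiLikeData.ric, trace_apply _ x L hL,
    LinearMap.trace_eq_sum_inner L (stdOrthonormalBasis ℝ (TangentSpace I (x : M))), ricci]
  refine Finset.sum_congr rfl fun i _ ↦ ?_
  set e := stdOrthonormalBasis ℝ (TangentSpace I (x : M)) i
  obtain ⟨X, hX⟩ := SmoothField.exists_apply_eq x e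
  have : curvature I (extend E e) (extend E (Y.1 x)) (extend E (Z.1 x)) x =
      (D.curv X Y Z).1 x := by
    rw [toData_curv_apply]
    exact curvature_congr hS hE (eventually_contMDiffAt_extend _ _) (X.eventually_contMDiffAt x)
      (eventually_contMDiffAt_extend _ _) (Y.eventually_contMDiffAt x)
      (eventually_contMDiffAt_extend _ _) (Z.eventually_contMDiffAt x)
      (by simp [hX]) (by simp) (by simp)
  rw [this, ← hX, hL, real_inner_comm]
  rfl

theorem toData_lieG_apply (v X Y : SmoothField I U) (x : U) :
    ((toData U hS hE).lieG v X Y).1 x = lieDerivMetric I v.zext X.zext Y.zext x := by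
  change (⁅v, metric I U X Y⁆ - metric I U ⁅v, X⁆ Y - metric I U X ⁅v, Y⁆).1 x = _
  simp [lieDerivMetric, lie_function_apply, zext_metric, lie_field_apply]

theorem lieDerivMetric_congr {v v' X Y : Π x : M, TangentSpace I x} {x : M}
    (h : ∀ᶠ y in 𝓝 x, v' y = v y) :
    lieDerivMetric I v' X Y x = lieDerivMetric I v X Y x := by
  have h1 (W : Π x : M, TangentSpace I x) : mlieBracket I v' W x = mlieBracket I v W x :=
    EventuallyEq.mlieBracket_vectorField_eq h .rfl
  rw [lieDerivMetric, lieDerivMetric, h.self_of_nhds, h1, h1]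

theorem isSoliton_toData {v : Π x : M, TangentSpace I x} (hv : CMDiff ∞ (T% v)) {lam mu nu : ℝ}
    (hsol : S.IsParaRicciLikeSoliton v lam mu nu) :
    (toData U hS hE).IsSoliton (.mk v fun x _ ↦ hv x) (.const lam) (.const mu)
      (.const (2 * n - lam - mu - nu)) where
  lie_l X := lie_const X _
  lie_m X := lie_const X _
  lie_c X := lie_const X _
  two_ric X Y := SmoothFunction.eq_of_apply fun x ↦ by
    have h := hsol x X.zext Y.zext (X.mdifferentiableAt x.2) (Y.mdifferentiableAt x.2)
    have h1 : SmoothFunction.eval x ((toData U hS hE).ric X Y) = _ := toData_ric_apply hS hE X Y x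
    have h2 : SmoothFunction.eval x ((toData U hS hE).lieG (.mk v fun x _ ↦ hv x) X Y) = _ :=
      (toData_lieG_apply hS hE (.mk v fun x _ ↦ hv x) X Y x).trans
        (lieDerivMetric_congr (zext_mk _ _ x.2))
    have hg (Z : SmoothField I U) : SmoothFunction.eval x ((toData U hS hE).g X Z) =
      inner ℝ (X.1 x) (Z.1 x) := metric_apply X Z x
    have hη (Z : SmoothField I U) : SmoothFunction.eval x ((toData U hS hE).η Z) =
      S.η x (Z.1 x) := S.ηField_apply Z x
    have hφ (Z : SmoothField I U) : ((toData U hS hE).φ Z).1 x = S.φ x (Z.1 x) :=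
      S.φField_apply Z x
    have hc (c : ℝ) : SmoothFunction.eval x (.const c : SmoothFunction I U) = c := rfl
    rw [← SmoothFunction.eval_apply, ← SmoothFunction.eval_apply]
    simp only [map_mul, map_sub, map_neg, map_add, h1, h2, hg, hη, hφ, hc, map_natCast, map_ofNat]
    rw [zext_coe, zext_coe, assocMetric] at h
    rw [h]
    ring

end RiemannianPiStructure

end PiDataOnFramedOpens

theorem theorem3p1 (n : ℕ) (hn : 1 ≤ n)
    {E : Type*} [NormedAddCommGroup E] [NormedSpace ℝ E] [FiniteDimensional ℝ E]
    (hE : Module.finrank ℝ E = 2 * n + 1)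
    {H : Type*} [TopologicalSpace H] (I : ModelWithCorners ℝ E H) [I.Boundaryless]
    {M : Type*} [TopologicalSpace M] [ChartedSpace H M] [IsManifold I ∞ M] [Nonempty M]
    [RiemannianBundle (fun x : M ↦ TangentSpace I x)]
    [IsContMDiffRiemannianBundle I ∞ E (fun x : M ↦ TangentSpace I x)]
    (S : RiemannianPiStructure I M) (hS : S.IsParaSasakiLike)
    (v : Π x : M, TangentSpace I x) (hv : CMDiff ∞ (T% v))
    (lam mu nu : ℝ) (hsol : S.IsParaRicciLikeSoliton v lam mu nu) :
    lam + mu + nu = 2 * n ∧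
      (∀ x : M, leviCivita I M v x (S.ξ x) = S.φ x (v x)) ∧
      (∀ x : M, mlieBracket I v S.ξ x = 0) := by
  have : Nontrivial E := Module.nontrivial_of_finrank_pos (R := ℝ) (by lia)
  suffices key : ∀ x : M, lam + mu + nu = 2 * n ∧ leviCivita I M v x (S.ξ x) = S.φ x (v x) ∧
      mlieBracket I v S.ξ x = 0 from
    ⟨(key (Classical.arbitrary M)).1, fun x ↦ (key x).2.1, fun x ↦ (key x).2.2⟩
  intro x
  let e := trivializationAt E (TangentSpace I : M → Type _) x
  let U : TopologicalSpace.Opens M := ⟨e.baseSet, e.open_baseSet⟩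
  have : FramedOpen I U := ⟨⟨x, subset_rfl⟩⟩
  let x' : U := ⟨x, FiberBundle.mem_baseSet_trivializationAt' x⟩
  let V : SmoothField I U := .mk v fun x _ ↦ hv x
  obtain ⟨h1, h2, h3⟩ := (RiemannianPiStructure.toData U hS hE).soliton_main
    (Nat.one_le_iff_ne_zero.1 hn) (RiemannianPiStructure.isSoliton_toData hS hE hv hsol)
  have hV := SmoothField.zext_mk v (fun x _ ↦ hv x) x'.2
  refine ⟨?_, ?_, ?_⟩
  · have := congr((SmoothFunction.eval x') $h1)
    change 2 * (n : ℝ) - lam - mu - nu = 0 at this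
    linarith
  · have h := congr((SmoothField.eval x') $h2)
    change (SmoothField.cov (S.ξField U) V).1 x' = (S.φField U V).1 x' at h
    rw [SmoothField.cov_apply, RiemannianPiStructure.φField_apply,
      leviCivita_congr hV] at h
    exact h
  · have h := congr((SmoothField.eval x') $h3)
    change mlieBracket I V.zext (S.ξField U).zext x = 0 at h
    exact (Filter.EventuallyEq.mlieBracket_vectorField_eq hV
      (SmoothField.zext_mk S.ξ (fun x _ ↦ S.contMDiff_ξ x) x'.2)).symm.trans h
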